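/- **Definitions.** A normalized weight function is a continuous nondecreasing $\omega:[0,\infty)\to[0,\infty)$ with $\omega(t)=0$ for $t\in[0,1]$ and $\lim_{t\to\infty}\omega(t)=\infty$; it satisfies $(\omega_3)$ if $\log t=o(\omega(t))$ as $t\to\infty$. For normalized weight functions $\sigma,\omega$ let $\gamma(\sigma,\omega)\in[0,\infty]$ be the supremum of all $r>0$ for which there is $C>0$ with $\int_1^\infty \omega(tu)\,u^{-1-1/r}\,du\le C\sigma(t)+C$ for all $t\ge 0$ (and $0$ if there is no such $r$). The weight matrix associated with $\omega$ is $\Omega=\{W^l:l>0\}$, $W^l_j=\exp\big(\tfrac1l\varphi^*_\omega(lj)\big)$, where $\varphi^*_\omega(x)=\sup_{y\ge0}\,(xy-\omega(e^y))$; $\Sigma=\{S^l:l>0\}$ is associated with $\sigma$ in the same way. Put $\widehat W^l=(p!\,W^l_p)_{p}$, $\widehat S^l=(p!\,S^l_p)_{p}$, $\widehat\Omega=\{\widehat W^l:l>0\}$, $\widehat\Sigma=\{\widehat S^l:l>0\}$. For $\gamma>0$ let $S_\gamma=\{z:|\arg z|<\gamma\pi/2\}$ be the unbounded sector in the Riemann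 surface of the logarithm. For a sequence $M$ of positive reals and $h>0$ let $\mathcal A_{M,h}(S_\gamma)$ be the space of holomorphic $f$ on $S_\gamma$ with norm $\sup_{z\in S_\gamma,\,p\in\mathbb N}|f^{(p)}(z)|/(h^pM_p)<\infty$, and $\Lambda_{M,h}$ the space of complex sequences with norm $\sup_p|a_p|/(h^pM_p)<\infty$. For a family $\mathcal M=\{M^x:x>0\}$ let $\mathcal A_{\{\mathcal M\}}(S_\gamma)=\bigcup_{x,h>0}\mathcal A_{M^x,h}(S_\gamma)$ and $\Lambda_{\{\mathcal M\}}=\bigcup_{x,h>0}\Lambda_{M^x,h}$. The Borel map is $\mathcal B(f)=\big(\lim_{z\to0,\,z\in S_\gamma}f^{(p)}(z)\big)_{p}$. **Theorem.** Let $\sigma,\omega$ be normalized weight functions satisfying $(\omega_3)$ with $\gamma(\sigma,\omega)>0$, and let $0<\gamma<\gamma(\sigma,\omega)$. Then: 1. There are $D\ge1$ and $C\in\mathbb R$ with $\omega(t)\le D\sigma(t)+C$ for all $t\ge0$. 2. There is a constant $k_0>0$ such that for every $D\ge1$ for which $\omega-D\sigma$ is bounded above on $[0,\infty)$, and for all $x>0$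 and $h>0$, there is a continuous linear map $E:\Lambda_{\widehat S^x,h}\to\mathcal A_{\widehat W^{8Dx},k_0h}(S_\gamma)$ with $\mathcal B(E(\lambda))=\lambda$ for every $\lambda\in\Lambda_{\widehat S^x,h}$. (In particular, if $\omega\le\sigma+C$ for some constant $C$, the target is $\mathcal A_{\widehat W^{8x},k_0h}(S_\gamma)$.) 3. Consequently $\mathcal B(\mathcal A_{\{\widehat\Omega\}}(S_\gamma))\supseteq\Lambda_{\{\widehat\Sigma\}}$. -/

import Mathlib

open Set Filter Topology MeasureTheory

noncomputable section

namespace MixedExt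

/-! ### Weight functions -/

/-- A weight function `ω : [0,∞) → [0,∞)`: continuous, nondecreasing, `ω 0 = 0` and `ω t → ∞`.
It is modelled as a function on `ℝ` of which only the values on `[0,∞)` are ever used
(nonnegativity there follows from monotonicity and `ω 0 = 0`). -/
structure IsWeightFunction (ω : ℝ → ℝ) : Prop where
  continuousOn : ContinuousOn ω (Ici 0)
  monotoneOn : MonotoneOn ω (Ici 0)
  map_zero : ω 0 = 0
  tendsto_atTop : Tendsto ω atTop atTop

/-- A normalized weight function: a weight function vanishing on `[0,1]`. -/
structure IsNormalizedWeightFunction (ω : ℝ → ℝ) : Prop extends IsWeightFunction ω where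
  normalized : ∀ t ∈ Icc (0 : ℝ) 1, ω t = 0

/-- Condition `(ω₃)`: `log t = o(ω t)` as `t → ∞`. -/
def Omega3 (ω : ℝ → ℝ) : Prop := Real.log =o[atTop] ω

/-- The growth condition `(σ,ω)_{γ_r}`: there is `C > 0` such that
`∫_1^∞ ω(tu) u^{-(1+1/r)} du ≤ C σ(t) + C` for all `t ≥ 0` (the integral being finite). -/
def MixedGrowth (σ ω : ℝ → ℝ) (r : ℝ) : Prop :=
  ∃ C : ℝ, 0 < C ∧ ∀ t : ℝ, 0 ≤ t →
    IntegrableOn (fun u : ℝ => ω (t * u) / u ^ (1 + 1 / r)) (Ioi 1) ∧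
      ∫ u in Ioi (1 : ℝ), ω (t * u) / u ^ (1 + 1 / r) ≤ C * σ t + C

/-- The mixed growth index `γ(σ,ω) ∈ [0,∞]`, the supremum of all `r > 0` such that
`(σ,ω)_{γ_r}` holds; it is `0` if there is no such `r`. -/
def mixedIndex (σ ω : ℝ → ℝ) : ENNReal :=
  sSup {s : ENNReal | ∃ r : ℝ, 0 < r ∧ MixedGrowth σ ω r ∧ s = ENNReal.ofReal r}

/-! ### Weight matrices -/

/-- The Legendre-Fenchel-Young conjugate `φ*_ω(x) = sup {x y - φ_ω(y) : y ≥ 0}` of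
`φ_ω(y) = ω(e^y)`. -/
def youngConj (ω : ℝ → ℝ) (x : ℝ) : ℝ := ⨆ y : Ici (0 : ℝ), (x * y - ω (Real.exp y))

/-- The weight matrix associated with `ω`: `W^l_j = exp (φ*_ω(l j) / l)`. -/
def weightMatrix (ω : ℝ → ℝ) (l : ℝ) (j : ℕ) : ℝ := Real.exp (1 / l * youngConj ω (l * j))

/-- The sequence `M̂ = (p! M_p)_p`. -/
def hat (M : ℕ → ℝ) (p : ℕ) : ℝ := (p.factorial : ℝ) * M p

/-! ### Spaces defined by weighted supremum norms -/

section Weighted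

variable {V ι : Type*} [AddCommGroup V] [Module ℂ V]

/-- The subspace of all `f` with `sup_i |T f i| / w i < ∞`. The absolute value around the
weight makes this a subspace for arbitrary real `w`; the weights of interest are positive. -/
def weightedSubmodule (T : V →ₗ[ℂ] (ι → ℂ)) (w : ι → ℝ) : Submodule ℂ V where
  carrier := {f | BddAbove (range fun i => ‖T f i‖ / |w i|)}
  zero_mem' := ⟨0, by rintro _ ⟨i, rfl⟩; simp⟩
  add_mem' := by
    rintro f g ⟨A, hA⟩ ⟨B, hB⟩
    refine ⟨A + B, ?_⟩
    rintro _ ⟨i, rfl⟩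
    have h1 := hA ⟨i, rfl⟩
    have h2 := hB ⟨i, rfl⟩
    calc ‖T (f + g) i‖ / |w i| ≤ (‖T f i‖ + ‖T g i‖) / |w i| := by
          rw [map_add]
          exact div_le_div_of_nonneg_right (norm_add_le _ _) (abs_nonneg _)
      _ = ‖T f i‖ / |w i| + ‖T g i‖ / |w i| := add_div _ _ _
      _ ≤ A + B := add_le_add h1 h2
  smul_mem' := by
    rintro c f ⟨A, hA⟩
    refine ⟨‖c‖ * A, ?_⟩
    rintro _ ⟨i, rfl⟩
    have h1 := hA ⟨i, rfl⟩
    calc ‖T (c • f) i‖ / |w i| = ‖c‖ * (‖T f i‖ / |w i|) := by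
          rw [map_smul, Pi.smul_apply, norm_smul, mul_div_assoc]
      _ ≤ ‖c‖ * A := mul_le_mul_of_nonneg_left h1 (norm_nonneg _)

/-- The same subspace as a type of its own, to be topologized by
`‖f‖ = sup_i |T f i| / |w i|` only. -/
def WeightedSpace (T : V →ₗ[ℂ] (ι → ℂ)) (w : ι → ℝ) : Type _ := weightedSubmodule T w

instance (T : V →ₗ[ℂ] (ι → ℂ)) (w : ι → ℝ) : AddCommGroup (WeightedSpace T w) :=
  inferInstanceAs (AddCommGroup (weightedSubmodule T w))

instance (T : V →ₗ[ℂ] (ι → ℂ)) (w : ι → ℝ) : Module ℂ (WeightedSpace T w) :=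
  inferInstanceAs (Module ℂ (weightedSubmodule T w))

/-- The underlying element of an element of a weighted space. -/
def WeightedSpace.val {T : V →ₗ[ℂ] (ι → ℂ)} {w : ι → ℝ} (f : WeightedSpace T w) : V :=
  Subtype.val (p := fun v => v ∈ weightedSubmodule T w) f

theorem WeightedSpace.bdd {T : V →ₗ[ℂ] (ι → ℂ)} {w : ι → ℝ} (f : WeightedSpace T w) :
    BddAbove (range fun i => ‖T f.val i‖ / |w i|) :=
  Subtype.property (p := fun v => v ∈ weightedSubmodule T w) f

theorem weighted_nonneg (T : V →ₗ[ℂ] (ι → ℂ)) (w : ι → ℝ) (f : V) :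
    0 ≤ ⨆ i, ‖T f i‖ / |w i| :=
  Real.iSup_nonneg fun _ => div_nonneg (norm_nonneg _) (abs_nonneg _)

instance (T : V →ₗ[ℂ] (ι → ℂ)) (w : ι → ℝ) : Norm (WeightedSpace T w) :=
  ⟨fun f => ⨆ i, ‖T f.val i‖ / |w i|⟩

theorem weighted_core (T : V →ₗ[ℂ] (ι → ℂ)) (w : ι → ℝ) :
    SeminormedSpace.Core ℂ (WeightedSpace T w) where
  norm_nonneg f := weighted_nonneg T w f.val
  norm_smul c f := by
    change (⨆ i, ‖T (c • f.val) i‖ / |w i|) = ‖c‖ * ⨆ i, ‖T f.val i‖ / |w i|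
    rw [Real.mul_iSup_of_nonneg (norm_nonneg c)]
    congr 1
    funext i
    rw [map_smul, Pi.smul_apply, norm_smul, mul_div_assoc]
  norm_triangle f g := by
    change (⨆ i, ‖T (f.val + g.val) i‖ / |w i|) ≤
      (⨆ i, ‖T f.val i‖ / |w i|) + ⨆ i, ‖T g.val i‖ / |w i|
    refine Real.iSup_le (fun i => ?_)
      (add_nonneg (weighted_nonneg T w f.val) (weighted_nonneg T w g.val))
    calc ‖T (f.val + g.val) i‖ / |w i| ≤ (‖T f.val i‖ + ‖T g.val i‖) / |w i| := by
          rw [map_add]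
          exact div_le_div_of_nonneg_right (norm_add_le _ _) (abs_nonneg _)
      _ = ‖T f.val i‖ / |w i| + ‖T g.val i‖ / |w i| := add_div _ _ _
      _ ≤ _ := add_le_add (le_ciSup f.bdd i) (le_ciSup g.bdd i)

instance (T : V →ₗ[ℂ] (ι → ℂ)) (w : ι → ℝ) : SeminormedAddCommGroup (WeightedSpace T w) :=
  SeminormedAddCommGroup.ofCore (weighted_core T w)

instance (T : V →ₗ[ℂ] (ι → ℂ)) (w : ι → ℝ) : NormedSpace ℂ (WeightedSpace T w) where
  norm_smul_le c f := ((weighted_core T w).norm_smul c f).le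

end Weighted

/-! ### Sectors of the Riemann surface of the logarithm and ultraholomorphic classes

A point `z` of the Riemann surface of the logarithm is represented by its logarithm
`w = log |z| + i arg z ∈ ℂ`, which is a global holomorphic coordinate. -/

/-- The unbounded sector `S_γ = {z : |arg z| < γ π / 2}` in the coordinate `w = log z`. -/
def sector (γ : ℝ) : Set ℂ := {w : ℂ | |w.im| < γ * Real.pi / 2}

/-- The derivative `d/dz` in the coordinate `w = log z`, that is `e^{-w} d/dw`. -/
def zDeriv (f : ℂ → ℂ) (w : ℂ) : ℂ := Complex.exp (-w) * deriv f w

/-- The filter `z → 0, z ∈ S_γ`; in the coordinate `w = log z`, this is `Re w → -∞`. -/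
def sectorZero (γ : ℝ) : Filter ℂ := comap Complex.re atBot ⊓ 𝓟 (sector γ)

theorem isOpen_sector (γ : ℝ) : IsOpen (sector γ) :=
  isOpen_lt (Complex.continuous_im.abs) continuous_const

theorem zDeriv_differentiableOn {γ : ℝ} {f : ℂ → ℂ} (hf : DifferentiableOn ℂ f (sector γ)) :
    DifferentiableOn ℂ (zDeriv f) (sector γ) :=
  ((Complex.differentiable_exp.comp differentiable_neg).differentiableOn).mul
    (hf.deriv (isOpen_sector γ))

theorem zDeriv_iter_differentiableOn {γ : ℝ} {f : ℂ → ℂ}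
    (hf : DifferentiableOn ℂ f (sector γ)) (p : ℕ) :
    DifferentiableOn ℂ (zDeriv^[p] f) (sector γ) := by
  induction p with
  | zero => exact hf
  | succ p ih =>
    rw [Function.iterate_succ_apply']
    exact zDeriv_differentiableOn ih

theorem zDeriv_congr {γ : ℝ} {f g : ℂ → ℂ} (h : EqOn f g (sector γ)) :
    EqOn (zDeriv f) (zDeriv g) (sector γ) := by
  intro w hw
  have : f =ᶠ[𝓝 w] g := h.eventuallyEq_of_mem ((isOpen_sector γ).mem_nhds hw)
  simp only [zDeriv, this.deriv_eq]

theorem zDeriv_iter_add {γ : ℝ} {f g : ℂ → ℂ} (hf : DifferentiableOn ℂ f (sector γ))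
    (hg : DifferentiableOn ℂ g (sector γ)) (p : ℕ) :
    EqOn (zDeriv^[p] (f + g)) (zDeriv^[p] f + zDeriv^[p] g) (sector γ) := by
  induction p with
  | zero => exact fun _ _ => rfl
  | succ p ih =>
    intro w hw
    have hw' := (isOpen_sector γ).mem_nhds hw
    simp only [Function.iterate_succ_apply', Pi.add_apply]
    rw [zDeriv_congr ih hw]
    simp only [zDeriv]
    rw [deriv_add ((zDeriv_iter_differentiableOn hf p).differentiableAt hw')
      ((zDeriv_iter_differentiableOn hg p).differentiableAt hw'), mul_add]

theorem zDeriv_iter_smul {γ : ℝ} {f : ℂ → ℂ} (hf : DifferentiableOn ℂ f (sector γ))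
    (c : ℂ) (p : ℕ) :
    EqOn (zDeriv^[p] (c • f)) (c • zDeriv^[p] f) (sector γ) := by
  induction p with
  | zero => exact fun _ _ => rfl
  | succ p ih =>
    intro w hw
    have hw' := (isOpen_sector γ).mem_nhds hw
    simp only [Function.iterate_succ_apply', Pi.smul_apply]
    rw [zDeriv_congr ih hw]
    simp only [zDeriv]
    rw [deriv_const_smul c ((zDeriv_iter_differentiableOn hf p).differentiableAt hw')]
    simp only [smul_eq_mul]
    ring

/-- `H(S_γ)`: the holomorphic functions on the sector. A function on the sector is represented
by its extension by `0` to all of `ℂ`. -/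
def Hol (γ : ℝ) : Submodule ℂ (ℂ → ℂ) where
  carrier := {f | DifferentiableOn ℂ f (sector γ) ∧ ∀ w ∉ sector γ, f w = 0}
  zero_mem' := ⟨differentiableOn_const 0, fun _ _ => rfl⟩
  add_mem' := fun hf hg =>
    ⟨hf.1.add hg.1, fun w hw => by simp [hf.2 w hw, hg.2 w hw]⟩
  smul_mem' := fun c _ hf => ⟨hf.1.const_smul c, fun w hw => by simp [hf.2 w hw]⟩

/-- All derivatives of a holomorphic function on the sector: `f ↦ (f^{(p)}(z))_{z,p}`. -/
def derivs (γ : ℝ) : Hol γ →ₗ[ℂ] (sector γ × ℕ → ℂ) where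
  toFun f := fun q => zDeriv^[q.2] (f : ℂ → ℂ) q.1
  map_add' f g := by
    funext q
    exact zDeriv_iter_add f.2.1 g.2.1 q.2 q.1.2
  map_smul' c f := by
    funext q
    exact zDeriv_iter_smul f.2.1 c q.2 q.1.2

/-- `Λ_{M,h}`: complex sequences with norm `sup_p |a_p| / (h^p M_p) < ∞`. -/
abbrev SeqSpace (M : ℕ → ℝ) (h : ℝ) : Type :=
  WeightedSpace (LinearMap.id : (ℕ → ℂ) →ₗ[ℂ] (ℕ → ℂ)) (fun p => h ^ p * M p)

/-- `𝒜_{M,h}(S_γ)`: holomorphic functions on the sector with norm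
`sup_{z,p} |f^{(p)}(z)| / (h^p M_p) < ∞`. -/
abbrev UltraHol (γ : ℝ) (M : ℕ → ℝ) (h : ℝ) : Type :=
  WeightedSpace (derivs γ) (fun q => h ^ q.2 * M q.2)

/-- `Λ_{{𝓜}}`, the union of all `Λ_{M^x,h}`, `x, h > 0`. -/
def roumieuSeq (𝓜 : ℝ → ℕ → ℝ) : Set (ℕ → ℂ) :=
  {a | ∃ x h : ℝ, 0 < x ∧ 0 < h ∧ ∃ b : SeqSpace (𝓜 x) h, b.val = a}

/-- `𝒜_{{𝓜}}(S_γ)`, the union of all `𝒜_{M^x,h}(S_γ)`, `x, h > 0`. -/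
def roumieuHol (γ : ℝ) (𝓜 : ℝ → ℕ → ℝ) : Set (Hol γ) :=
  {f | ∃ x h : ℝ, 0 < x ∧ 0 < h ∧ ∃ g : UltraHol γ (𝓜 x) h, g.val = f}

/-- `ℬ f = a`, the graph of the Borel map: for every `p` the limit `f^{(p)}(0)` of `f^{(p)}(z)`
as `z → 0` in the sector exists and equals `a_p`. -/
def IsBorelImage {γ : ℝ} (f : Hol γ) (a : ℕ → ℂ) : Prop :=
  ∀ p : ℕ, Tendsto (zDeriv^[p] (f : ℂ → ℂ)) (sectorZero γ) (𝓝 (a p))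

/-- `ℬ(A)` for a set `A` of holomorphic functions on the sector. -/
def borelImage {γ : ℝ} (A : Set (Hol γ)) : Set (ℕ → ℂ) :=
  {a | ∃ f ∈ A, IsBorelImage f a}

end MixedExt

end

open Set Filter Topology MeasureTheory

noncomputable section

namespace MixedExt

/-! ### Holomorphy of parametric integrals -/

/-! The extension operator is a truncated Laplace transform whose kernel is an optimal flat
function. Fix r > γ for which the mixed growth condition holds and write z = e^w.

Flat function. The kernel Z/(t+Z)² has nonnegative real part on the right half-plane, and over t >
|Z| its real part has integral exactly 1/2. Integrating τ(t) = ω(t^r) against it, with Z = z^(1/r),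
gives a holomorphic H on S_r with Re H(z) ≥ ω(|z|)/2 (`IsAdmissible.le_re_kernelTransform`). On the
positive ray the growth condition bounds the tail of the integral, so that H ≤ ω(K·) + σ(K·) + 1;
the constant C of the condition is absorbed into the dilation K, and σ keeps the coefficient 1
(`MixedGrowth.exists_flat_exponent`).

Kernel. Take q = z·exp(-H/(2Dx)). Since ω + σ ≤ 2Dσ + const, its moments m_k dominate S^x_k up to a
geometric factor (`weightMatrix_le_moment`). Conversely |q| ≤ |z|·exp(-ω(|z|)/(4Dx)), so |z|^N |q|
is at most a constant times W^{8Dx}_N, with integrable decay left over (`exists_exp_mul_exp_le`).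
Thus 8 = 2·2·2: from D+1 ≤ 2D, from the 1/2 in the bound on Re H, and from the decay.

Extension. For a in the sequence space, b_k = a_k/(k! m_k) grows at most geometrically, so ∑ b_k u^k
converges near 0. Its truncation to half of the guaranteed disc is integrated against q(u/z) du/u.
Monomials u^k go exactly to m_k z^k (`laplace_exp`), hence the result has the expansion ∑ a_k z^k/k!
with N-th remainder bounded geometrically times W_N |z|^N (`norm_truncLaplace_sub_le`). Cauchy
estimates on discs of radius ρ|z|, which fit into S_r because γ < r, turn this into derivative
bounds and boundary values on S_γ (`zDeriv_iter_of_expansion`). Only K and ρ enter k₀, so it depends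
on neither D, x nor h. -/

theorem differentiableOn_integral_of_dominated {α : Type*} [MeasurableSpace α] {μ : Measure α}
    {U : Set ℂ} (hU : IsOpen U) {F : ℂ → α → ℂ}
    (hmeas : ∀ z ∈ U, AEStronglyMeasurable (F z) μ)
    (hdiff : ∀ᵐ a ∂μ, DifferentiableOn ℂ (fun z => F z a) U)
    (hbound : ∀ z₀ ∈ U, ∃ V ∈ 𝓝 z₀, ∃ bound : α → ℝ, Integrable bound μ ∧
      ∀ᵐ a ∂μ, ∀ z ∈ V, ‖F z a‖ ≤ bound a) :
    DifferentiableOn ℂ (fun z => ∫ a, F z a ∂μ) U := by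
  intro z₀ hz₀
  obtain ⟨V, hV, bound, hbi, hb⟩ := hbound z₀ hz₀
  obtain ⟨ε, hε, hball⟩ := Metric.mem_nhds_iff.1 (inter_mem hV (hU.mem_nhds hz₀))
  have hsub : Metric.ball z₀ ε ⊆ U := fun z hz => (hball hz).2
  have hmeas' : ∀ᶠ z in 𝓝 z₀, AEStronglyMeasurable (F z) μ := by
    filter_upwards [hU.mem_nhds hz₀] with z hz using hmeas z hz
  have hint : Integrable (F z₀) μ := by
    refine hbi.mono' (hmeas z₀ hz₀) ?_
    filter_upwards [hb] with a ha using ha z₀ (mem_of_mem_nhds hV)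
  have hderivAt : ∀ᵐ a ∂μ, ∀ z ∈ Metric.ball z₀ (ε / 2),
      HasDerivAt (fun z => F z a) (deriv (fun z => F z a) z) z := by
    filter_upwards [hdiff] with a ha z hz
    exact (ha.differentiableAt (hU.mem_nhds
      (hsub (Metric.ball_subset_ball (by linarith) hz)))).hasDerivAt
  -- Only the integrand is assumed dominated; Cauchy's inequality on circles of radius ε/4 transfers
  -- the domination to its derivative.
  have hderivBound : ∀ᵐ a ∂μ, ∀ z ∈ Metric.ball z₀ (ε / 2),
      ‖deriv (fun z => F z a) z‖ ≤ bound a / (ε / 4) := by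
    filter_upwards [hdiff, hb] with a ha hba z hz
    have hcl : Metric.closedBall z (ε / 4) ⊆ Metric.ball z₀ ε := by
      intro y hy
      rw [Metric.mem_closedBall] at hy
      rw [Metric.mem_ball] at hz ⊢
      linarith [dist_triangle y z z₀]
    refine Complex.norm_deriv_le_of_forall_mem_sphere_norm_le (by positivity) ?_ ?_
    · exact (ha.mono (hcl.trans hsub)).diffContOnCl_ball Subset.rfl
    · intro y hy
      exact hba y (hball (hcl (Metric.sphere_subset_closedBall hy))).1
  -- The derivative is measurable as an almost everywhere limit of difference quotients along a
  -- sequence tending to z₀ inside the ball.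
  have hderivMeas : AEStronglyMeasurable (fun a => deriv (fun z => F z a) z₀) μ := by
    have hseq : ∀ n : ℕ, z₀ + ((ε / 2 / ((n : ℝ) + 1) : ℝ) : ℂ) ∈ Metric.ball z₀ ε := by
      intro n
      rw [Metric.mem_ball, dist_eq_norm, add_sub_cancel_left, Complex.norm_real, Real.norm_eq_abs,
        abs_of_pos (by positivity)]
      have : ε / 2 / ((n : ℝ) + 1) ≤ ε / 2 :=
        div_le_self (by positivity) (by linarith [Nat.cast_nonneg (α := ℝ) n])
      linarith
    refine aestronglyMeasurable_of_tendsto_ae atTop (f := fun (n : ℕ) a =>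
      ((ε / 2 / ((n : ℝ) + 1) : ℝ) : ℂ)⁻¹ •
        (F (z₀ + ((ε / 2 / ((n : ℝ) + 1) : ℝ) : ℂ)) a - F z₀ a)) ?_ ?_
    · intro n
      exact ((hmeas _ (hsub (hseq n))).sub (hmeas z₀ hz₀)).const_smul
        (((ε / 2 / ((n : ℝ) + 1) : ℝ) : ℂ)⁻¹)
    · filter_upwards [hderivAt] with a ha
      have h1 := (ha z₀ (Metric.mem_ball_self (by positivity))).tendsto_slope_zero
      refine h1.comp (tendsto_nhdsWithin_iff.2 ⟨?_, ?_⟩)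
      · have h2 : Tendsto (fun n : ℕ => ε / 2 / ((n : ℝ) + 1)) atTop (𝓝 0) :=
          tendsto_const_nhds.div_atTop
            (tendsto_atTop_add_const_right _ _ tendsto_natCast_atTop_atTop)
        exact_mod_cast (Complex.continuous_ofReal.tendsto 0).comp h2
      · refine Eventually.of_forall fun n => ?_
        have : (0 : ℝ) < ε / 2 / ((n : ℝ) + 1) := by positivity
        simpa using Complex.ofReal_ne_zero.2 this.ne'
  exact (hasDerivAt_integral_of_dominated_loc_of_deriv_le
    (Metric.ball_mem_nhds z₀ (half_pos hε)) hmeas' hint hderivMeas hderivBound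
    (hbi.div_const _) hderivAt).2.differentiableAt.differentiableWithinAt

/-! ### The kernel `Z / (t + Z)²` on the right half-plane -/

theorem sq_add_sq_le_norm_add_sq {Z : ℂ} (hZ : 0 ≤ Z.re) {t : ℝ} (ht : 0 ≤ t) :
    t ^ 2 + ‖Z‖ ^ 2 ≤ ‖(t : ℂ) + Z‖ ^ 2 := by
  rw [Complex.sq_norm, Complex.sq_norm, Complex.normSq_apply, Complex.normSq_apply]
  simp only [Complex.add_re, Complex.ofReal_re, Complex.add_im, Complex.ofReal_im]
  nlinarith [mul_nonneg ht hZ]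

theorem ofReal_add_ne_zero {Z : ℂ} (hZ : 0 < Z.re) {t : ℝ} (ht : 0 ≤ t) : (t : ℂ) + Z ≠ 0 := by
  intro h
  have := congrArg Complex.re h
  simp at this
  linarith

theorem norm_kernel_le {Z : ℂ} (hZ : 0 < Z.re) {t : ℝ} (ht : 0 ≤ t) :
    ‖Z / ((t : ℂ) + Z) ^ 2‖ ≤ (‖Z‖ + ‖Z‖⁻¹) * (1 / (1 + t ^ 2)) := by
  have hn : 0 < ‖Z‖ := norm_pos_iff.2 fun h => by simp [h] at hZ
  rw [norm_div, norm_pow]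
  calc ‖Z‖ / ‖(t : ℂ) + Z‖ ^ 2 ≤ ‖Z‖ / (t ^ 2 + ‖Z‖ ^ 2) := by
        gcongr
        exact sq_add_sq_le_norm_add_sq hZ.le ht
    _ ≤ _ := by
        rw [mul_one_div, div_le_div_iff₀ (by positivity) (by positivity)]
        have : (‖Z‖ + ‖Z‖⁻¹) * (t ^ 2 + ‖Z‖ ^ 2)
            = ‖Z‖ * (1 + t ^ 2) + ‖Z‖⁻¹ * t ^ 2 + ‖Z‖ ^ 3 := by
          field_simp; ring
        rw [this]
        have : 0 ≤ ‖Z‖⁻¹ * t ^ 2 := by positivity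
        have : 0 ≤ ‖Z‖ ^ 3 := by positivity
        linarith

theorem re_kernel_nonneg {Z : ℂ} (hZ : 0 < Z.re) {t : ℝ} (ht : 0 ≤ t) :
    0 ≤ (Z / ((t : ℂ) + Z) ^ 2).re := by
  rw [Complex.div_re, ← add_div]
  refine div_nonneg ?_ (Complex.normSq_nonneg _)
  have : Z.re * (((t : ℂ) + Z) ^ 2).re + Z.im * (((t : ℂ) + Z) ^ 2).im
      = Z.re * t ^ 2 + 2 * t * (Z.re ^ 2 + Z.im ^ 2) + Z.re * (Z.re ^ 2 + Z.im ^ 2) := by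
    simp [pow_two]
    ring
  rw [this]
  positivity

theorem integrableOn_kernel {Z : ℂ} (hZ : 0 < Z.re) :
    IntegrableOn (fun t : ℝ => Z / ((t : ℂ) + Z) ^ 2) (Ioi 0) := by
  refine Integrable.mono' (g := fun t : ℝ => (‖Z‖ + ‖Z‖⁻¹) * (1 / (1 + t ^ 2))) ?_ ?_ ?_
  · simp only [one_div]
    exact (integrable_inv_one_add_sq.const_mul (‖Z‖ + ‖Z‖⁻¹)).integrableOn
  · refine ContinuousOn.aestronglyMeasurable ?_ measurableSet_Ioi
    refine continuousOn_const.div (by fun_prop) fun t ht => ?_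
    exact pow_ne_zero _ (ofReal_add_ne_zero hZ (le_of_lt ht))
  · filter_upwards [ae_restrict_mem measurableSet_Ioi] with t ht using norm_kernel_le hZ (le_of_lt ht)

theorem integral_kernel {Z : ℂ} (hZ : 0 < Z.re) {A : ℝ} (hA : 0 ≤ A) :
    ∫ t in Ioi A, Z / ((t : ℂ) + Z) ^ 2 = Z / (A + Z) := by
  have h := integral_Ioi_of_hasDerivAt_of_tendsto' (a := A) (m := 0)
    (f := fun t : ℝ => -(Z / ((t : ℂ) + Z))) (f' := fun t : ℝ => Z / ((t : ℂ) + Z) ^ 2) ?_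
    ((integrableOn_kernel hZ).mono_set (Ioi_subset_Ioi hA)) ?_
  · simpa using h
  · intro t ht
    have h1 : HasDerivAt (fun t : ℝ => (t : ℂ) + Z) 1 t :=
      (Complex.ofRealCLM.hasDerivAt (x := t)).add_const Z
    have h2 := ((hasDerivAt_const t Z).div h1
      (ofReal_add_ne_zero hZ (hA.trans ht))).neg
    convert! h2 using 1
    simp [neg_div]
  · rw [← neg_zero]
    refine Tendsto.neg ?_
    rw [tendsto_zero_iff_norm_tendsto_zero]
    refine squeeze_zero' (Eventually.of_forall fun _ => norm_nonneg _) (g := fun t => ‖Z‖ / t) ?_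
      (tendsto_const_nhds.div_atTop tendsto_id)
    filter_upwards [eventually_gt_atTop 0] with t ht
    rw [norm_div]
    gcongr
    have h1 := sq_add_sq_le_norm_add_sq hZ.le ht.le
    exact (abs_le_of_sq_le_sq' (by nlinarith [sq_nonneg ‖Z‖]) (norm_nonneg _)).2

/-- The integral is Re(Z/(|Z|+Z)), and 1/(1+e^{-iθ}) has real part 1/2 whatever the argument θ of Z.
This makes the lower bound for Re H uniform on the whole sector. -/
theorem integral_re_kernel_norm {Z : ℂ} (hZ : 0 < Z.re) :
    ∫ t in Ioi ‖Z‖, (Z / ((t : ℂ) + Z) ^ 2).re = 1 / 2 := by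
  have hn : 0 < ‖Z‖ := norm_pos_iff.2 fun h => by simp [h] at hZ
  have h1 : ∫ t in Ioi ‖Z‖, (Z / ((t : ℂ) + Z) ^ 2).re
      = (∫ t in Ioi ‖Z‖, Z / ((t : ℂ) + Z) ^ 2).re :=
    integral_re ((integrableOn_kernel hZ).mono_set (Ioi_subset_Ioi hn.le))
  rw [h1, integral_kernel hZ hn.le, Complex.div_re, ← add_div, div_eq_div_iff]
  · have h2 : ‖Z‖ ^ 2 = Z.re * Z.re + Z.im * Z.im := by
      rw [Complex.sq_norm, Complex.normSq_apply]
    simp [Complex.normSq_apply]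
    nlinarith
  · exact fun h => ofReal_add_ne_zero hZ hn.le (Complex.normSq_eq_zero.1 h)
  · norm_num

/-- The transform `Z ↦ ∫₀^∞ τ(t) Z / (t + Z)² dt`, holomorphic on the right half-plane. -/
def kernelTransform (τ : ℝ → ℝ) (Z : ℂ) : ℂ :=
  ∫ t in Ioi (0 : ℝ), (τ t : ℂ) * (Z / ((t : ℂ) + Z) ^ 2)

theorem kernelTransform_ofReal (τ : ℝ → ℝ) (S : ℝ) :
    kernelTransform τ S = ((∫ t in Ioi (0 : ℝ), τ t * (S / (t + S) ^ 2) : ℝ) : ℂ) := by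
  rw [kernelTransform, ← integral_complex_ofReal]
  push_cast
  rfl

/-- Nonnegative nondecreasing functions on `(0,∞)` with `∫^∞ τ(t) t⁻² dt < ∞`. -/
structure IsAdmissible (τ : ℝ → ℝ) : Prop where
  mono : MonotoneOn τ (Ioi 0)
  nonneg : ∀ t, 0 < t → 0 ≤ τ t
  integrable : IntegrableOn (fun t => τ t / t ^ 2) (Ioi 1)

namespace IsAdmissible

variable {τ : ℝ → ℝ} (h : IsAdmissible τ)
include h

theorem aestronglyMeasurable : AEStronglyMeasurable τ (volume.restrict (Ioi 0)) :=
  (aemeasurable_restrict_of_monotoneOn measurableSet_Ioi h.mono).aestronglyMeasurable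

theorem integrableOn_div_one_add_sq :
    IntegrableOn (fun t => τ t * (1 / (1 + t ^ 2))) (Ioi 0) := by
  have hm : AEStronglyMeasurable (fun t => τ t * (1 / (1 + t ^ 2))) (volume.restrict (Ioi 0)) :=
    h.aestronglyMeasurable.mul (Measurable.aestronglyMeasurable (by fun_prop))
  rw [← Ioc_union_Ioi_eq_Ioi (zero_le_one (α := ℝ))]
  refine IntegrableOn.union ?_ ?_
  · refine IntegrableOn.of_bound (by simp) (hm.mono_measure
      (Measure.restrict_mono Ioc_subset_Ioi_self le_rfl)) (τ 1) ?_
    filter_upwards [ae_restrict_mem measurableSet_Ioc] with t ht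
    have h0 := h.nonneg t ht.1
    have h1 : τ t ≤ τ 1 := h.mono ht.1 (mem_Ioi.2 one_pos) ht.2
    rw [Real.norm_of_nonneg (by positivity)]
    refine (mul_le_of_le_one_right h0 ?_).trans h1
    rw [div_le_one (by positivity)]
    nlinarith [sq_nonneg t]
  · refine h.integrable.mono' (hm.mono_measure
      (Measure.restrict_mono (Ioi_subset_Ioi zero_le_one) le_rfl)) ?_
    filter_upwards [ae_restrict_mem measurableSet_Ioi] with t ht
    have ht0 : 0 < t := one_pos.trans ht
    have h0 := h.nonneg t ht0
    rw [Real.norm_of_nonneg (by positivity), mul_one_div]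
    gcongr
    linarith

theorem norm_mul_kernel_le {Z : ℂ} (hZ : 0 < Z.re) {t : ℝ} (ht : 0 < t) :
    ‖(τ t : ℂ) * (Z / ((t : ℂ) + Z) ^ 2)‖ ≤ (‖Z‖ + ‖Z‖⁻¹) * (τ t * (1 / (1 + t ^ 2))) := by
  rw [norm_mul, Complex.norm_real, Real.norm_of_nonneg (h.nonneg t ht), mul_left_comm]
  exact mul_le_mul_of_nonneg_left (norm_kernel_le hZ ht.le) (h.nonneg t ht)

theorem aestronglyMeasurable_mul_kernel {Z : ℂ} (hZ : 0 < Z.re) :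
    AEStronglyMeasurable (fun t : ℝ => (τ t : ℂ) * (Z / ((t : ℂ) + Z) ^ 2))
      (volume.restrict (Ioi 0)) :=
  (Complex.continuous_ofReal.comp_aestronglyMeasurable h.aestronglyMeasurable).mul
    (integrableOn_kernel hZ).aestronglyMeasurable

theorem integrableOn_mul_kernel {Z : ℂ} (hZ : 0 < Z.re) :
    IntegrableOn (fun t : ℝ => (τ t : ℂ) * (Z / ((t : ℂ) + Z) ^ 2)) (Ioi 0) := by
  refine (h.integrableOn_div_one_add_sq.const_mul (‖Z‖ + ‖Z‖⁻¹)).mono'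
    (h.aestronglyMeasurable_mul_kernel hZ) ?_
  filter_upwards [ae_restrict_mem measurableSet_Ioi] with t ht using h.norm_mul_kernel_le hZ ht

theorem differentiableOn_kernelTransform :
    DifferentiableOn ℂ (kernelTransform τ) {Z | 0 < Z.re} := by
  refine differentiableOn_integral_of_dominated (isOpen_lt continuous_const Complex.continuous_re)
    (fun Z hZ => h.aestronglyMeasurable_mul_kernel hZ) ?_ ?_
  · filter_upwards [ae_restrict_mem measurableSet_Ioi] with t ht
    refine (differentiableOn_id.div (by fun_prop) fun Z hZ => ?_).const_mul _
    exact pow_ne_zero _ (ofReal_add_ne_zero hZ (le_of_lt ht))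
  · intro Z₀ hZ₀
    have hn : Z₀ ≠ 0 := fun h => by simp [h] at hZ₀
    have hc : ContinuousAt (fun Z : ℂ => ‖Z‖ + ‖Z‖⁻¹) Z₀ :=
      continuousAt_id.norm.add (continuousAt_id.norm.inv₀ (by simpa using hn))
    refine ⟨_, inter_mem ((isOpen_lt continuous_const Complex.continuous_re).mem_nhds hZ₀)
      (hc.eventually_lt_const (lt_add_one _)), _,
      h.integrableOn_div_one_add_sq.const_mul (‖Z₀‖ + ‖Z₀‖⁻¹ + 1), ?_⟩
    filter_upwards [ae_restrict_mem measurableSet_Ioi] with t ht Z hZ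
    refine (h.norm_mul_kernel_le hZ.1 ht).trans ?_
    have h0 := h.nonneg t ht
    have := hZ.2
    simp only [mem_ofPred_eq] at this
    gcongr

/-- The real part of the kernel is nonnegative, so the part t ≤ |Z| may be dropped; on the rest τ(t)
≥ τ(|Z|) and the kernel has mass 1/2. -/
theorem le_re_kernelTransform {Z : ℂ} (hZ : 0 < Z.re) :
    τ ‖Z‖ / 2 ≤ (kernelTransform τ Z).re := by
  have hn : 0 < ‖Z‖ := norm_pos_iff.2 fun h => by simp [h] at hZ
  have hre : (kernelTransform τ Z).re
      = ∫ t in Ioi (0 : ℝ), τ t * (Z / ((t : ℂ) + Z) ^ 2).re := by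
    rw [kernelTransform]
    refine (integral_re (h.integrableOn_mul_kernel hZ)).symm.trans ?_
    refine integral_congr_ae (Eventually.of_forall fun t => ?_)
    simp only [RCLike.re_eq_complex_re, Complex.re_ofReal_mul]
  have hint : IntegrableOn (fun t : ℝ => τ t * (Z / ((t : ℂ) + Z) ^ 2).re) (Ioi 0) := by
    refine (h.integrableOn_mul_kernel hZ).re.congr (Eventually.of_forall fun t => ?_)
    simp only [RCLike.re_eq_complex_re, Complex.re_ofReal_mul]
  have hker : IntegrableOn (fun t : ℝ => (Z / ((t : ℂ) + Z) ^ 2).re) (Ioi ‖Z‖) :=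
    ((integrableOn_kernel hZ).mono_set (Ioi_subset_Ioi hn.le)).re
  calc τ ‖Z‖ / 2 = ∫ t in Ioi ‖Z‖, τ ‖Z‖ * (Z / ((t : ℂ) + Z) ^ 2).re := by
        rw [integral_const_mul, integral_re_kernel_norm hZ]
        ring
    _ ≤ ∫ t in Ioi ‖Z‖, τ t * (Z / ((t : ℂ) + Z) ^ 2).re := by
        refine setIntegral_mono_on (hker.const_mul _) (hint.mono_set (Ioi_subset_Ioi hn.le))
          measurableSet_Ioi fun t ht => ?_
        have ht0 : 0 < t := hn.trans ht
        exact mul_le_mul_of_nonneg_right (h.mono hn ht0 (le_of_lt ht))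
          (re_kernel_nonneg hZ ht0.le)
    _ ≤ ∫ t in Ioi (0 : ℝ), τ t * (Z / ((t : ℂ) + Z) ^ 2).re := by
        refine setIntegral_mono_set hint ?_ (Ioi_subset_Ioi hn.le).eventuallyLE
        filter_upwards [ae_restrict_mem measurableSet_Ioi] with t ht
        exact mul_nonneg (h.nonneg t ht) (re_kernel_nonneg hZ (le_of_lt ht))
    _ = _ := hre.symm

/-- For real Z = S the kernel is a probability density on (0,∞). Below T monotonicity gives τ(T);
above T, S/(t+S)² ≤ S/t². The cut T stays free so that it can later be a large multiple of S. -/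
theorem kernelTransform_ofReal_le {S T : ℝ} (hS : 0 < S) (hT : 0 < T) :
    (kernelTransform τ S).re ≤ τ T + S * ∫ t in Ioi T, τ t / t ^ 2 := by
  have hZ : 0 < (S : ℂ).re := by simpa using hS
  have hker : IntegrableOn (fun t : ℝ => S / (t + S) ^ 2) (Ioi 0) := by
    refine (integrableOn_kernel hZ).re.congr (Eventually.of_forall fun t => ?_)
    simp only [RCLike.re_eq_complex_re]
    rw [show (S : ℂ) / ((t : ℂ) + S) ^ 2 = ((S / (t + S) ^ 2 : ℝ) : ℂ) by push_cast; rfl,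
      Complex.ofReal_re]
  have hker1 : ∫ t in Ioi (0 : ℝ), S / (t + S) ^ 2 = 1 := by
    have := integral_kernel hZ le_rfl
    rw [Complex.ofReal_zero, zero_add, div_self (Complex.ofReal_ne_zero.2 hS.ne')] at this
    have h2 : ((∫ t in Ioi (0 : ℝ), S / (t + S) ^ 2 : ℝ) : ℂ) = 1 := by
      rw [← integral_complex_ofReal, ← this]
      push_cast
      rfl
    exact_mod_cast h2
  have hint : IntegrableOn (fun t : ℝ => τ t * (S / (t + S) ^ 2)) (Ioi 0) := by
    refine (h.integrableOn_mul_kernel hZ).re.congr (Eventually.of_forall fun t => ?_)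
    simp only [RCLike.re_eq_complex_re]
    rw [show (τ t : ℂ) * ((S : ℂ) / ((t : ℂ) + S) ^ 2) = ((τ t * (S / (t + S) ^ 2) : ℝ) : ℂ) by
      push_cast; rfl, Complex.ofReal_re]
  have hint2 : IntegrableOn (fun t : ℝ => τ t / t ^ 2) (Ioi T) := by
    refine ((h.integrableOn_div_one_add_sq.mono_set (Ioi_subset_Ioi hT.le)).const_mul
      ((1 + T ^ 2) / T ^ 2)).mono' ?_ ?_
    · exact (h.aestronglyMeasurable.mono_measure (Measure.restrict_mono
        (Ioi_subset_Ioi hT.le) le_rfl)).mul (measurable_id.pow_const 2).inv.aestronglyMeasurable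
    · filter_upwards [ae_restrict_mem measurableSet_Ioi] with t ht
      have ht0 : 0 < t := hT.trans ht
      have h0 := h.nonneg t ht0
      rw [Real.norm_of_nonneg (by positivity), mul_left_comm, div_eq_mul_one_div]
      refine mul_le_mul_of_nonneg_left ?_ h0
      rw [mul_one_div, div_div, div_le_div_iff₀ (by positivity) (by positivity)]
      have : T ^ 2 ≤ t ^ 2 := pow_le_pow_left₀ hT.le (le_of_lt ht) 2
      nlinarith
  rw [kernelTransform_ofReal, Complex.ofReal_re, ← Ioc_union_Ioi_eq_Ioi hT.le,
    setIntegral_union Ioc_disjoint_Ioi_same measurableSet_Ioi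
      (hint.mono_set Ioc_subset_Ioi_self) (hint.mono_set (Ioi_subset_Ioi hT.le))]
  refine add_le_add ?_ ?_
  · calc ∫ t in Ioc 0 T, τ t * (S / (t + S) ^ 2) ≤ ∫ t in Ioc 0 T, τ T * (S / (t + S) ^ 2) := by
          refine setIntegral_mono_on (hint.mono_set Ioc_subset_Ioi_self)
            ((hker.mono_set Ioc_subset_Ioi_self).const_mul _) measurableSet_Ioc fun t ht => ?_
          have := h.mono ht.1 hT ht.2
          gcongr
      _ ≤ ∫ t in Ioi 0, τ T * (S / (t + S) ^ 2) := by
          refine setIntegral_mono_set (hker.const_mul _) (Eventually.of_forall fun t => ?_)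
            Ioc_subset_Ioi_self.eventuallyLE
          have := h.nonneg T hT
          exact mul_nonneg this (div_nonneg hS.le (sq_nonneg _))
      _ = τ T := by rw [integral_const_mul, hker1, mul_one]
  · rw [← integral_const_mul]
    refine setIntegral_mono_on (hint.mono_set (Ioi_subset_Ioi hT.le)) (hint2.const_mul _)
      measurableSet_Ioi fun t ht => ?_
    have ht0 : 0 < t := hT.trans ht
    have h0 := h.nonneg t ht0
    rw [mul_div_assoc', mul_div_assoc', mul_comm S]
    gcongr
    linarith

end IsAdmissible

/-! ### Weight functions and weight matrices -/

theorem IsWeightFunction.nonneg {ω : ℝ → ℝ} (hω : IsWeightFunction ω) {t : ℝ} (ht : 0 ≤ t) :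
    0 ≤ ω t := by
  rw [← hω.map_zero]
  exact hω.monotoneOn self_mem_Ici ht ht

theorem Omega3.exists_mul_le {ω : ℝ → ℝ} (hω : IsWeightFunction ω) (h3 : Omega3 ω) {c : ℝ}
    (hc : 0 < c) : ∃ B : ℝ, 0 ≤ B ∧ ∀ y : ℝ, 0 ≤ y → c * y ≤ ω (Real.exp y) + B := by
  have h1 := h3.def (inv_pos.2 hc)
  obtain ⟨t₀, ht₀⟩ := eventually_atTop.1 h1
  refine ⟨c * |Real.log (max t₀ 1)|, by positivity, fun y hy => ?_⟩
  have hnn := hω.nonneg (Real.exp_pos y).le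
  rcases le_total t₀ (Real.exp y) with h | h
  · have h2 := ht₀ _ h
    rw [Real.log_exp, Real.norm_of_nonneg hy, Real.norm_of_nonneg hnn, inv_mul_eq_div,
      le_div_iff₀ hc] at h2
    have : 0 ≤ c * |Real.log (max t₀ 1)| := by positivity
    linarith
  · have h2 : y ≤ Real.log (max t₀ 1) := by
      rw [Real.le_log_iff_exp_le (by positivity)]
      exact h.trans (le_max_left _ _)
    have h3 : c * y ≤ c * |Real.log (max t₀ 1)| := by
      gcongr
      exact h2.trans (le_abs_self _)
    linarith

/-- Needed for the supremum in `youngConj` to be genuine: a real supremum over an unbounded family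
takes the default value 0. -/
theorem Omega3.bddAbove {ω : ℝ → ℝ} (hω : IsWeightFunction ω) (h3 : Omega3 ω) (x : ℝ) :
    BddAbove (range fun y : Ici (0 : ℝ) => x * y - ω (Real.exp y)) := by
  obtain ⟨B, -, hB⟩ := h3.exists_mul_le hω (c := |x| + 1) (by positivity)
  refine ⟨B, ?_⟩
  rintro _ ⟨⟨y, hy⟩, rfl⟩
  have h1 := hB y hy
  have h2 : x * y ≤ (|x| + 1) * y := by
    have : x ≤ |x| + 1 := by linarith [le_abs_self x]
    exact mul_le_mul_of_nonneg_right this hy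
  simp only
  linarith

/-- Together with `weightMatrix_le` this identifies W^l_k with the supremum of t^k exp(-ω(t)/l) over
t = e^y ≥ 1, the only form in which the matrix is used. -/
theorem exp_le_weightMatrix {ω : ℝ → ℝ} (hω : IsWeightFunction ω) (h3 : Omega3 ω) {l : ℝ}
    (hl : 0 < l) (k : ℕ) {y : ℝ} (hy : 0 ≤ y) :
    Real.exp (k * y - ω (Real.exp y) / l) ≤ weightMatrix ω l k := by
  rw [weightMatrix, Real.exp_le_exp]
  have h1 := le_ciSup (h3.bddAbove hω (l * k)) ⟨y, hy⟩
  have h2 := mul_le_mul_of_nonneg_left h1 (one_div_pos.2 hl).le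
  refine le_trans (le_of_eq ?_) h2
  field_simp

theorem one_le_weightMatrix {ω : ℝ → ℝ} (hω : IsNormalizedWeightFunction ω) (h3 : Omega3 ω) {l : ℝ}
    (hl : 0 < l) (k : ℕ) : 1 ≤ weightMatrix ω l k := by
  have h1 := exp_le_weightMatrix hω.toIsWeightFunction h3 hl k le_rfl
  rw [Real.exp_zero, hω.normalized 1 (by simp)] at h1
  simpa using h1

theorem weightMatrix_le {ω : ℝ → ℝ} {l : ℝ} (hl : 0 < l) (k : ℕ) {B : ℝ}
    (h : ∀ y : ℝ, 0 ≤ y → Real.exp (k * y - ω (Real.exp y) / l) ≤ B) :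
    weightMatrix ω l k ≤ B := by
  have hB : 0 < B := (Real.exp_pos _).trans_le (h 0 le_rfl)
  rw [weightMatrix, ← Real.le_log_iff_exp_le hB, one_div, inv_mul_le_iff₀ hl]
  refine ciSup_le fun y => ?_
  have h1 := (Real.le_log_iff_exp_le hB).2 (h y y.2)
  have h2 := mul_le_mul_of_nonneg_left h1 hl.le
  refine le_trans (le_of_eq ?_) h2
  field_simp

theorem weightMatrix_pos (ω : ℝ → ℝ) (l : ℝ) (k : ℕ) : 0 < weightMatrix ω l k := Real.exp_pos _

/-- The decay of `exp (x - ω(e^x)/l)` against `exp (N x)`, uniformly in `N`; the index of the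
weight matrix is doubled. -/
theorem exists_exp_mul_exp_le {ω : ℝ → ℝ} (hω : IsNormalizedWeightFunction ω) (h3 : Omega3 ω)
    {l : ℝ} (hl : 0 < l) : ∃ C : ℝ, 0 < C ∧ ∀ (N : ℕ) (x : ℝ),
      Real.exp (N * x) * Real.exp (x - ω (Real.exp x) / l) ≤
        C * weightMatrix ω (2 * l) N * Real.exp (-|x|) := by
  -- With c = 4l one gets 2x ≤ (ω(e^x) + B)/(2l): half of the exponent ω/l cancels e^x and leaves
  -- e^{-x}, the other half produces the matrix entry of index 2l.
  obtain ⟨B, hB0, hB⟩ := h3.exists_mul_le hω.toIsWeightFunction (c := 2 * (2 * l)) (by positivity)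
  refine ⟨Real.exp (B / (2 * l)), Real.exp_pos _, fun N x => ?_⟩
  have hC : 1 ≤ Real.exp (B / (2 * l)) := Real.one_le_exp (by positivity)
  have hW := one_le_weightMatrix hω h3 (by positivity : 0 < 2 * l) N
  have hnn : 0 ≤ ω (Real.exp x) / l := div_nonneg (hω.nonneg (Real.exp_pos x).le) hl.le
  rw [← Real.exp_add]
  rcases le_total x 0 with hx | hx
  · calc Real.exp (N * x + (x - ω (Real.exp x) / l)) ≤ Real.exp (-|x|) := by
          rw [abs_of_nonpos hx, Real.exp_le_exp]
          have : (N : ℝ) * x ≤ 0 := mul_nonpos_of_nonneg_of_nonpos (Nat.cast_nonneg _) hx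
          linarith
      _ ≤ _ := le_mul_of_one_le_left (Real.exp_pos _).le (one_le_mul_of_one_le_of_one_le hC hW)
  · have h1 := exp_le_weightMatrix hω.toIsWeightFunction h3 (by positivity : 0 < 2 * l) N hx
    have h2 : 2 * x ≤ ω (Real.exp x) / (2 * l) + B / (2 * l) := by
      rw [← add_div, le_div_iff₀ (by positivity)]
      linarith [hB x hx]
    calc Real.exp (N * x + (x - ω (Real.exp x) / l))
        ≤ Real.exp (B / (2 * l) + (N * x - ω (Real.exp x) / (2 * l)) + -|x|) := by
          rw [abs_of_nonneg hx, Real.exp_le_exp]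
          have : ω (Real.exp x) / l = ω (Real.exp x) / (2 * l) + ω (Real.exp x) / (2 * l) := by
            field_simp; ring
          linarith
      _ = Real.exp (B / (2 * l)) * Real.exp (N * x - ω (Real.exp x) / (2 * l)) *
            Real.exp (-|x|) := by rw [Real.exp_add, Real.exp_add]
      _ ≤ _ := by gcongr

/-! ### Consequences of the mixed growth condition -/

section MixedGrowth

variable {σ ω : ℝ → ℝ} {r : ℝ}

theorem rpow_mul_comp_eq (ω : ℝ → ℝ) (s : ℝ) {x : ℝ} (hx : 0 < x) (hr : 0 < r) :
    x ^ (r - 1) * (ω (s * x ^ r) / (x ^ r) ^ (1 + 1 / r)) = ω (s * x ^ r) / x ^ 2 := by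
  have h1 : (x ^ r) ^ (1 + 1 / r) = x ^ (r - 1) * x ^ 2 := by
    rw [← Real.rpow_mul hx.le, ← Real.rpow_natCast x 2, ← Real.rpow_add hx]
    congr 1
    push_cast
    field_simp
    ring
  have h2 : x ^ (r - 1) ≠ 0 := (Real.rpow_pos_of_pos hx _).ne'
  rw [h1]
  field_simp

/-- The substitution u = x^r turns the weight u^{-1-1/r} of the growth condition into x^{-2}, the
tail weight of the half-plane kernel. -/
theorem integral_Ioi_one_comp_rpow (ω : ℝ → ℝ) (s : ℝ) (hr : 0 < r) :
    r * ∫ x in Ioi (1 : ℝ), ω (s * x ^ r) / x ^ 2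
      = ∫ u in Ioi (1 : ℝ), ω (s * u) / u ^ (1 + 1 / r) := by
  rw [← integral_comp_rpow_Ioi_of_pos' (g := fun u => ω (s * u) / u ^ (1 + 1 / r)) hr zero_le_one,
    Real.one_rpow, ← integral_const_mul]
  refine setIntegral_congr_fun measurableSet_Ioi fun x hx => ?_
  have hx0 : (0 : ℝ) < x := one_pos.trans hx
  simp only [smul_eq_mul]
  rw [mul_assoc, rpow_mul_comp_eq ω s hx0 hr]

theorem isAdmissible_comp_rpow (hω : IsWeightFunction ω) (hr : 0 < r)
    (h : IntegrableOn (fun u : ℝ => ω u / u ^ (1 + 1 / r)) (Ioi 1)) :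
    IsAdmissible (fun t => ω (t ^ r)) where
  mono s hs t _ hst := hω.monotoneOn (mem_Ici.2 (Real.rpow_nonneg (le_of_lt hs) _))
    (mem_Ici.2 (Real.rpow_nonneg (le_of_lt (lt_of_lt_of_le hs hst)) _))
    (Real.rpow_le_rpow (le_of_lt hs) hst hr.le)
  nonneg t ht := hω.nonneg (Real.rpow_nonneg ht.le _)
  integrable := by
    -- The change of variables is available on all of (0,∞); the indicators of (1,∞) correspond
    -- because x > 1 exactly when x^r > 1.
    rw [← integrable_indicator_iff measurableSet_Ioi] at h ⊢
    have h1 := (integrableOn_Ioi_comp_rpow_iff' _ hr.ne').2 (h.integrableOn (s := Ioi 0))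
    have h2 := (integrable_indicator_iff measurableSet_Ioi).2 h1
    refine h2.congr (Eventually.of_forall fun x => ?_)
    by_cases hx : x ∈ Ioi (0 : ℝ)
    · rw [indicator_of_mem hx]
      by_cases hx1 : x ∈ Ioi (1 : ℝ)
      · rw [indicator_of_mem hx1, indicator_of_mem (mem_Ioi.2 (Real.one_lt_rpow hx1 hr)),
          smul_eq_mul]
        simpa using rpow_mul_comp_eq ω 1 hx hr
      · rw [indicator_of_notMem hx1, indicator_of_notMem, smul_zero]
        exact fun h3 => absurd (Real.rpow_le_one (le_of_lt hx) (not_lt.1 hx1) hr.le) (not_le.2 h3)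
    · have hx1 : x ∉ Ioi (1 : ℝ) := fun h3 => hx (mem_Ioi.2 (one_pos.trans (mem_Ioi.1 h3)))
      rw [indicator_of_notMem hx, indicator_of_notMem hx1]

theorem mul_integral_Ioi_comp_rpow (ω : ℝ → ℝ) (hr : 0 < r) {T : ℝ} (hT : 0 < T) :
    T * ∫ t in Ioi T, ω (t ^ r) / t ^ 2
      = 1 / r * ∫ u in Ioi (1 : ℝ), ω (T ^ r * u) / u ^ (1 + 1 / r) := by
  rw [← integral_Ioi_one_comp_rpow ω _ hr, ← mul_assoc, one_div_mul_cancel hr.ne', one_mul]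
  have h1 := integral_comp_mul_left_Ioi' (fun t => ω (t ^ r) / t ^ 2) 1 hT
  rw [mul_one] at h1
  rw [← h1, smul_eq_mul, ← mul_assoc, ← integral_const_mul]
  refine setIntegral_congr_fun measurableSet_Ioi fun x hx => ?_
  have hx0 : (0 : ℝ) < x := one_pos.trans hx
  rw [Real.mul_rpow hT.le hx0.le, mul_pow]
  field_simp

/-- Since ω(tu) ≥ ω(t) for u ≥ 1 and u^{-1-1/r} has integral r over (1,∞), the left side of the
growth condition is at least rω(t). -/
theorem MixedGrowth.exists_le (hω : IsWeightFunction ω) (hσ : IsWeightFunction σ) (hr : 0 < r)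
    (h : MixedGrowth σ ω r) : ∃ D : ℝ, 1 ≤ D ∧ ∃ C : ℝ, ∀ t : ℝ, 0 ≤ t → ω t ≤ D * σ t + C := by
  obtain ⟨C, hC, hint⟩ := h
  refine ⟨C / r + 1, by linarith [div_pos hC hr], C / r, fun t ht => ?_⟩
  obtain ⟨h1, h2⟩ := hint t ht
  have hlt : -(1 + 1 / r) < -1 := by linarith [one_div_pos.2 hr]
  have h3 : ∫ u in Ioi (1 : ℝ), ω t * u ^ (-(1 + 1 / r)) = r * ω t := by
    rw [integral_const_mul, integral_Ioi_rpow_of_lt hlt one_pos]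
    simp only [Real.one_rpow]
    rw [show -(1 + 1 / r) + 1 = -(1 / r) by ring]
    field_simp
  have h4 : r * ω t ≤ ∫ u in Ioi (1 : ℝ), ω (t * u) / u ^ (1 + 1 / r) := by
    rw [← h3]
    refine setIntegral_mono_on ((integrableOn_Ioi_rpow_of_lt hlt one_pos).const_mul _) h1
      measurableSet_Ioi fun u hu => ?_
    have hu1 : (1 : ℝ) < u := hu
    have hu0 : (0 : ℝ) < u := one_pos.trans hu
    rw [Real.rpow_neg hu0.le, ← div_eq_mul_inv]
    gcongr
    exact hω.monotoneOn ht (mem_Ici.2 (by positivity)) (le_mul_of_one_le_right ht hu1.le)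
  have h5 : ω t ≤ C / r * σ t + C / r := by
    rw [div_mul_eq_mul_div, ← add_div, le_div_iff₀ hr]
    linarith
  have := hσ.nonneg ht
  linarith

/-- The exponent of an optimal flat function on the sector `S_r`: its real part dominates
`ω(|z|)/2`, and on the half-line it is controlled by `ω + σ` up to a dilation. -/
theorem MixedGrowth.exists_flat_exponent (hω : IsWeightFunction ω) (hσ : IsWeightFunction σ)
    (hr : 0 < r) (h : MixedGrowth σ ω r) :
    ∃ H : ℂ → ℂ, ∃ K : ℝ, 1 ≤ K ∧ DifferentiableOn ℂ H (sector r) ∧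
      (∀ w ∈ sector r, ω (Real.exp w.re) / 2 ≤ (H w).re) ∧
      ∀ x : ℝ, (H x).im = 0 ∧ (H x).re ≤ ω (K * Real.exp x) + σ (K * Real.exp x) + 1 := by
  obtain ⟨C, hC, hint⟩ := h
  have hadm : IsAdmissible (fun t => ω (t ^ r)) := by
    refine isAdmissible_comp_rpow hω hr ?_
    simpa using (hint 1 zero_le_one).1
  set κ : ℝ := max 1 (C / r) with hκ
  have hκ1 : 1 ≤ κ := le_max_left _ _
  have hκ0 : 0 < κ := one_pos.trans_le hκ1
  have hre : ∀ w ∈ sector r, 0 < (Complex.exp (w / r)).re := by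
    intro w hw
    rw [Complex.exp_re, Complex.div_ofReal_im]
    refine mul_pos (Real.exp_pos _) (Real.cos_pos_of_mem_Ioo ?_)
    rw [sector, mem_ofPred_eq, abs_lt] at hw
    rw [mem_Ioo, lt_div_iff₀ hr, div_lt_iff₀ hr]
    constructor <;> nlinarith [hw.1, hw.2]
  refine ⟨fun w => kernelTransform (fun t => ω (t ^ r)) (Complex.exp (w / r)), κ ^ r,
    Real.one_le_rpow hκ1 hr.le, ?_, ?_, ?_⟩
  · exact hadm.differentiableOn_kernelTransform.comp (by fun_prop) hre
  · intro w hw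
    have h1 := hadm.le_re_kernelTransform (hre w hw)
    rw [Complex.norm_exp, Complex.div_ofReal_re] at h1
    rwa [← Real.exp_mul, div_mul_cancel₀ _ hr.ne'] at h1
  · intro x
    have hS : Complex.exp ((x : ℂ) / r) = ((Real.exp (x / r) : ℝ) : ℂ) := by push_cast; rfl
    simp only [hS]
    refine ⟨by rw [kernelTransform_ofReal, Complex.ofReal_im], ?_⟩
    set T := κ * Real.exp (x / r) with hT
    have hT0 : 0 < T := by positivity
    have hTr : T ^ r = κ ^ r * Real.exp x := by
      rw [hT, Real.mul_rpow hκ0.le (Real.exp_pos _).le, ← Real.exp_mul, div_mul_cancel₀ _ hr.ne']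
    have h1 := hadm.kernelTransform_ofReal_le (Real.exp_pos (x / r)) hT0
    have h2 := mul_integral_Ioi_comp_rpow ω hr hT0
    have h3 := (hint (T ^ r) (Real.rpow_nonneg hT0.le _)).2
    rw [hTr] at h2 h3
    simp only [hTr] at h1
    have hσ0 : 0 ≤ σ (κ ^ r * Real.exp x) := hσ.nonneg (by positivity)
    have h4 : Real.exp (x / r) * ∫ t in Ioi T, ω (t ^ r) / t ^ 2 ≤ σ (κ ^ r * Real.exp x) + 1 := by
      refine le_of_mul_le_mul_left ?_ hκ0
      rw [← mul_assoc, ← hT, h2]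
      calc 1 / r * ∫ u in Ioi (1 : ℝ), ω (κ ^ r * Real.exp x * u) / u ^ (1 + 1 / r)
          ≤ 1 / r * (C * σ (κ ^ r * Real.exp x) + C) := by gcongr
        _ = C / r * (σ (κ ^ r * Real.exp x) + 1) := by ring
        _ ≤ κ * (σ (κ ^ r * Real.exp x) + 1) := by
            gcongr
            exact le_max_right _ _
    linarith

end MixedGrowth

theorem exists_mixedGrowth_of_lt {σ ω : ℝ → ℝ} {γ : ℝ}
    (h : ENNReal.ofReal γ < mixedIndex σ ω) : ∃ r : ℝ, γ < r ∧ MixedGrowth σ ω r := by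
  obtain ⟨_, ⟨r, hr, hg, rfl⟩, hlt⟩ := lt_sSup_iff.1 h
  exact ⟨r, (ENNReal.ofReal_lt_ofReal_iff hr).1 hlt, hg⟩

/-! ### Laplace-type transforms on a sector -/

theorem integrable_exp_neg_abs : Integrable fun x : ℝ => Real.exp (-|x|) := by
  rw [← integrableOn_univ, ← Iic_union_Ioi (a := (0 : ℝ))]
  refine IntegrableOn.union ?_ ?_
  · refine (integrableOn_exp_Iic 0).congr_fun (fun x hx => ?_) measurableSet_Iic
    rw [abs_of_nonpos hx, neg_neg]
  · refine (integrableOn_exp_neg_Ioi 0).congr_fun (fun x hx => ?_) measurableSet_Ioi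
    rw [abs_of_pos hx]

theorem convex_sector (γ : ℝ) : Convex ℝ (sector γ) := by
  have h : sector γ = Complex.imLm ⁻¹' Ioo (-(γ * Real.pi / 2)) (γ * Real.pi / 2) := by
    ext w
    simp [sector, abs_lt]
  rw [h]
  exact (convex_Ioo _ _).linear_preimage _

theorem ofReal_sub_mem_sector {r : ℝ} {w : ℂ} (hw : w ∈ sector r) (y : ℝ) :
    (y : ℂ) - w ∈ sector r := by
  simpa [sector] using hw

section Laplace

variable {q : ℂ → ℂ} {r : ℝ} {g : ℝ → ℂ} {A M : ℝ} {N : ℕ} {w : ℂ}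

theorem continuous_comp_ofReal_sub (hq : DifferentiableOn ℂ q (sector r)) (hw : w ∈ sector r) :
    Continuous fun y : ℝ => q (y - w) :=
  hq.continuousOn.comp_continuous (by fun_prop) fun y => ofReal_sub_mem_sector hw y

/-- With u = e^y and z = e^w, the integral of q(y-w)g(y) dy is a Mellin-type Laplace transform with
measure du/u. Writing Ny = N Re w + N(y - Re w) extracts the factor |z|^N. -/
theorem norm_laplace_integrand_le
    (hb : ∀ w ∈ sector r, Real.exp (N * w.re) * ‖q w‖ ≤ M * Real.exp (-|w.re|))
    (hg : ∀ y, ‖g y‖ ≤ A * Real.exp (N * y)) (hw : w ∈ sector r) (y : ℝ) :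
    ‖q (y - w) * g y‖ ≤ A * M * Real.exp (N * w.re) * Real.exp (-|y - w.re|) := by
  have h1 := hb _ (ofReal_sub_mem_sector hw y)
  rw [Complex.sub_re, Complex.ofReal_re] at h1
  have hA : 0 ≤ A := nonneg_of_mul_nonneg_left ((norm_nonneg _).trans (hg y)) (Real.exp_pos _)
  rw [norm_mul]
  calc ‖q (y - w)‖ * ‖g y‖ ≤ ‖q (y - w)‖ * (A * Real.exp (N * y)) := by gcongr; exact hg y
    _ = A * Real.exp (N * w.re) * (Real.exp (N * (y - w.re)) * ‖q (y - w)‖) := by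
        rw [show (N : ℝ) * y = N * w.re + N * (y - w.re) by ring, Real.exp_add]
        ring
    _ ≤ A * Real.exp (N * w.re) * (M * Real.exp (-|y - w.re|)) := by gcongr
    _ = _ := by ring

theorem integrable_laplace (hq : DifferentiableOn ℂ q (sector r))
    (hb : ∀ w ∈ sector r, Real.exp (N * w.re) * ‖q w‖ ≤ M * Real.exp (-|w.re|))
    (hgm : AEStronglyMeasurable g) (hg : ∀ y, ‖g y‖ ≤ A * Real.exp (N * y)) (hw : w ∈ sector r) :
    Integrable fun y : ℝ => q (y - w) * g y :=
  ((integrable_exp_neg_abs.comp_sub_right w.re).const_mul _).mono'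
    ((continuous_comp_ofReal_sub hq hw).aestronglyMeasurable.mul hgm)
    (Eventually.of_forall fun y => norm_laplace_integrand_le hb hg hw y)

theorem norm_laplace_le
    (hb : ∀ w ∈ sector r, Real.exp (N * w.re) * ‖q w‖ ≤ M * Real.exp (-|w.re|))
    (hg : ∀ y, ‖g y‖ ≤ A * Real.exp (N * y)) (hw : w ∈ sector r) :
    ‖∫ y : ℝ, q (y - w) * g y‖ ≤
      A * M * (∫ x : ℝ, Real.exp (-|x|)) * Real.exp (N * w.re) := by
  refine (norm_integral_le_of_norm_le ((integrable_exp_neg_abs.comp_sub_right w.re).const_mul _)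
    (Eventually.of_forall fun y => norm_laplace_integrand_le hb hg hw y)).trans (le_of_eq ?_)
  rw [integral_const_mul, integral_sub_right_eq_self (fun x => Real.exp (-|x|))]
  ring

theorem differentiableOn_laplace (hq : DifferentiableOn ℂ q (sector r))
    (hb : ∀ w ∈ sector r, ‖q w‖ ≤ M * Real.exp (-|w.re|))
    (hgm : AEStronglyMeasurable g) (hg : ∀ y, ‖g y‖ ≤ A) :
    DifferentiableOn ℂ (fun w => ∫ y : ℝ, q (y - w) * g y) (sector r) := by
  have hb' : ∀ w ∈ sector r,
      Real.exp ((0 : ℕ) * w.re) * ‖q w‖ ≤ M * Real.exp (-|w.re|) := by simpa using hb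
  have hg' : ∀ y, ‖g y‖ ≤ A * Real.exp ((0 : ℕ) * y) := by simpa using hg
  refine differentiableOn_integral_of_dominated (isOpen_sector r) (fun w hw =>
    (continuous_comp_ofReal_sub hq hw).aestronglyMeasurable.mul hgm) ?_ ?_
  · refine Eventually.of_forall fun y => DifferentiableOn.mul_const ?_ _
    exact hq.comp (by fun_prop) fun w hw => ofReal_sub_mem_sector hw y
  · intro w₀ hw₀
    have hA : 0 ≤ A := (norm_nonneg _).trans (hg 0)
    have hM : 0 ≤ M :=
      nonneg_of_mul_nonneg_left ((norm_nonneg _).trans (hb w₀ hw₀)) (Real.exp_pos _)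
    refine ⟨_, inter_mem ((isOpen_sector r).mem_nhds hw₀) (Metric.ball_mem_nhds w₀ one_pos), _,
      (integrable_exp_neg_abs.comp_sub_right w₀.re).const_mul (A * M * Real.exp 1),
      Eventually.of_forall fun y w hw => ?_⟩
    refine (norm_laplace_integrand_le hb' hg' hw.1 y).trans ?_
    have h1 : |w.re - w₀.re| ≤ 1 := by
      have h2 := Complex.abs_re_le_norm (w - w₀)
      have h3 := hw.2
      rw [Metric.mem_ball, dist_eq_norm] at h3
      rw [Complex.sub_re] at h2
      linarith
    have h2 : |y - w₀.re| ≤ |y - w.re| + |w.re - w₀.re| := abs_sub_le _ _ _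
    rw [Nat.cast_zero, zero_mul, Real.exp_zero, mul_one, mul_assoc (A * M), ← Real.exp_add]
    gcongr
    linarith

/-- The moments `∫ q(x) e^{kx} dx`. -/
def moment (q : ℂ → ℂ) (k : ℕ) : ℂ := ∫ x : ℝ, q x * Real.exp (k * x)

/-- This replaces a rotation of the contour. The function Φ(w) = ∫ Q(y-w) dy with Q = q·e^{N·} is
holomorphic and invariant under real translations, so its derivative vanishes; it is therefore
constant on the connected sector and equals its value at 0, the moment. -/
theorem laplace_exp (hq : DifferentiableOn ℂ q (sector r)) (hr : 0 < r)
    (hb : ∀ w ∈ sector r, Real.exp (N * w.re) * ‖q w‖ ≤ M * Real.exp (-|w.re|))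
    (hw : w ∈ sector r) :
    ∫ y : ℝ, q (y - w) * Real.exp (N * y) = moment q N * Complex.exp w ^ N := by
  set Q : ℂ → ℂ := fun w => q w * Complex.exp (N * w) with hQ
  set Φ : ℂ → ℂ := fun w => ∫ y : ℝ, Q (y - w) * 1 with hΦ
  have hΦd : DifferentiableOn ℂ Φ (sector r) := by
    refine differentiableOn_laplace (M := M) (A := 1) ?_ (fun w hw => ?_)
      aestronglyMeasurable_const (by simp)
    · exact hq.mul (by fun_prop)
    · have h1 := hb w hw
      rw [hQ]
      simp only [norm_mul, Complex.norm_exp]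
      rw [mul_comm]
      simpa using h1
  have hshift : ∀ (w : ℂ) (s : ℝ), Φ (w + s) = Φ w := by
    intro w s
    simp only [hΦ]
    rw [← integral_add_right_eq_self _ s]
    refine integral_congr_ae (Eventually.of_forall fun y => ?_)
    simp only
    congr 2
    push_cast
    ring
  have hderiv : EqOn (deriv Φ) 0 (sector r) := by
    intro w hw
    have h1 : HasDerivAt Φ (deriv Φ w) (w + ((0 : ℝ) : ℂ)) := by
      rw [Complex.ofReal_zero, add_zero]
      exact (hΦd.differentiableAt ((isOpen_sector r).mem_nhds hw)).hasDerivAt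
    have h2 : HasDerivAt (fun s : ℝ => w + (s : ℂ)) 1 0 :=
      (Complex.ofRealCLM.hasDerivAt (x := (0 : ℝ))).const_add w
    have h3 := h1.comp (0 : ℝ) h2
    have h4 : (Φ ∘ fun s : ℝ => w + (s : ℂ)) = fun _ => Φ w := funext fun s => hshift w s
    rw [h4, mul_one] at h3
    exact h3.unique (hasDerivAt_const _ _)
  have h0 : (0 : ℂ) ∈ sector r := by
    simp only [sector, mem_ofPred_eq, Complex.zero_im, abs_zero]
    positivity
  have hconst : Φ w = Φ 0 := (isOpen_sector r).is_const_of_deriv_eq_zero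
    (convex_sector r).isPreconnected hΦd hderiv hw h0
  have hm : Φ 0 = moment q N := by
    simp only [hΦ, hQ, moment]
    refine integral_congr_ae (Eventually.of_forall fun y => ?_)
    simp
  rw [← hm, ← hconst]
  simp only [hΦ]
  rw [← integral_mul_const]
  refine integral_congr_ae (Eventually.of_forall fun y => ?_)
  simp only [hQ, mul_one]
  rw [← Complex.exp_nat_mul, mul_assoc, ← Complex.exp_add]
  push_cast
  ring_nf

end Laplace

/-! ### Cauchy estimates on sectors -/

theorem zDeriv_iter_congr {γ : ℝ} {f g : ℂ → ℂ} (h : EqOn f g (sector γ)) (p : ℕ) :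
    EqOn (zDeriv^[p] f) (zDeriv^[p] g) (sector γ) := by
  induction p with
  | zero => exact h
  | succ p ih =>
    rw [Function.iterate_succ_apply', Function.iterate_succ_apply']
    exact zDeriv_congr ih

theorem zDeriv_polynomial_exp (P : Polynomial ℂ) :
    zDeriv (fun w => P.eval (Complex.exp w)) = fun w => P.derivative.eval (Complex.exp w) := by
  funext w
  have h := (P.hasDerivAt (Complex.exp w)).comp w (Complex.hasDerivAt_exp w)
  have h' : deriv (fun w => P.eval (Complex.exp w)) w
      = P.derivative.eval (Complex.exp w) * Complex.exp w := h.deriv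
  rw [zDeriv, h', mul_left_comm, ← Complex.exp_add, neg_add_cancel, Complex.exp_zero, mul_one]

theorem zDeriv_iter_polynomial_exp (P : Polynomial ℂ) (p : ℕ) :
    zDeriv^[p] (fun w => P.eval (Complex.exp w))
      = fun w => (Polynomial.derivative^[p] P).eval (Complex.exp w) := by
  induction p with
  | zero => rfl
  | succ p ih =>
    rw [Function.iterate_succ_apply', ih, zDeriv_polynomial_exp, Function.iterate_succ_apply']

/-- A radius `ρ` such that the discs `|z - z₀| ≤ ρ |z₀|` with center in `S_γ` lie in `S_r`. -/
theorem exists_radius {γ r : ℝ} (h : γ < r) : ∃ ρ : ℝ, 0 < ρ ∧ ρ < 1 ∧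
    ∀ w ∈ sector γ, ∀ ζ : ℂ, ‖ζ‖ ≤ ρ → w + Complex.log (1 + ζ) ∈ sector r := by
  have hc : ContinuousAt (fun ζ : ℂ => |(Complex.log (1 + ζ)).im|) 0 := by
    refine (Complex.continuous_im.continuousAt.comp (ContinuousAt.clog (by fun_prop) ?_)).abs
    simp [Complex.one_mem_slitPlane]
  have hδ : 0 < (r - γ) * Real.pi / 2 := by
    have := Real.pi_pos
    have := sub_pos.2 h
    positivity
  have hev : ∀ᶠ ζ : ℂ in 𝓝 0, |(Complex.log (1 + ζ)).im| < (r - γ) * Real.pi / 2 :=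
    hc.eventually_lt_const (by simpa using hδ)
  obtain ⟨ε, hε, hball⟩ := Metric.eventually_nhds_iff.1 hev
  refine ⟨min (ε / 2) (1 / 2), by positivity, by
    linarith [min_le_right (ε / 2) (1 / 2 : ℝ)], fun w hw ζ hζ => ?_⟩
  have h1 : |(Complex.log (1 + ζ)).im| < (r - γ) * Real.pi / 2 := by
    refine hball ?_
    rw [dist_zero_right]
    linarith [min_le_left (ε / 2) (1 / 2 : ℝ)]
  simp only [sector, mem_ofPred_eq, Complex.add_im] at hw ⊢
  have h2 := abs_add_le w.im (Complex.log (1 + ζ)).im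
  have h3 : (r - γ) * Real.pi / 2 = r * Real.pi / 2 - γ * Real.pi / 2 := by ring
  linarith

/-- Cauchy's estimate on the circle |ζ| = ρ for ζ ↦ f(z(1+ζ)), that is, at the points w + log(1+ζ).
The p-th derivative at ζ = 0 is z^p f^{(p)}(z), and |z(1+ζ)| ≤ (1+ρ)|z| costs the factor (1+ρ)^n. -/
theorem norm_zDeriv_iter_le {γ r ρ : ℝ} (hρ0 : 0 < ρ) (hρ1 : ρ < 1)
    (hρ : ∀ w ∈ sector γ, ∀ ζ : ℂ, ‖ζ‖ ≤ ρ → w + Complex.log (1 + ζ) ∈ sector r)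
    {f : ℂ → ℂ} (hf : DifferentiableOn ℂ f (sector r)) {B : ℝ} {n : ℕ}
    (hB : ∀ w ∈ sector r, ‖f w‖ ≤ B * Real.exp (n * w.re)) (p : ℕ) {w : ℂ} (hw : w ∈ sector γ) :
    Real.exp (p * w.re) * ‖zDeriv^[p] f w‖ ≤
      p.factorial * (B * (1 + ρ) ^ n * Real.exp (n * w.re)) / ρ ^ p := by
  have hB0 : 0 ≤ B := by
    have h := hB w (by simpa using hρ w hw 0 (by simpa using hρ0.le))
    exact nonneg_of_mul_nonneg_left ((norm_nonneg _).trans h) (Real.exp_pos _)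
  have hslit : ∀ ζ : ℂ, ‖ζ‖ ≤ ρ → 1 + ζ ∈ Complex.slitPlane := fun ζ hζ =>
    Complex.mem_slitPlane_of_norm_lt_one (hζ.trans_lt hρ1)
  have hiter : ∀ p : ℕ, ∀ ζ ∈ Metric.ball (0 : ℂ) ρ,
      iteratedDeriv p (fun ζ => f (w + Complex.log (1 + ζ))) ζ
        = Complex.exp w ^ p * zDeriv^[p] f (w + Complex.log (1 + ζ)) := by
    intro p
    induction p with
    | zero => simp
    | succ p ih =>
      intro ζ hζ
      have hζ' : ‖ζ‖ ≤ ρ := (mem_ball_zero_iff.1 hζ).le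
      have hev : iteratedDeriv p (fun ζ => f (w + Complex.log (1 + ζ))) =ᶠ[𝓝 ζ]
          fun ζ => Complex.exp w ^ p * zDeriv^[p] f (w + Complex.log (1 + ζ)) := by
        filter_upwards [Metric.isOpen_ball.mem_nhds hζ] with ξ hξ using ih ξ hξ
      rw [iteratedDeriv_succ, hev.deriv_eq, Function.iterate_succ_apply', zDeriv]
      have h1 : HasDerivAt (fun ζ : ℂ => w + Complex.log (1 + ζ)) (1 / (1 + ζ)) ζ :=
        (((hasDerivAt_id ζ).const_add 1).clog (hslit ζ hζ')).const_add w
      have h2 : DifferentiableAt ℂ (zDeriv^[p] f) (w + Complex.log (1 + ζ)) :=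
        (zDeriv_iter_differentiableOn hf p).differentiableAt
          ((isOpen_sector r).mem_nhds (hρ w hw ζ hζ'))
      have h3 := ((h2.hasDerivAt.comp ζ h1).const_mul (Complex.exp w ^ p)).deriv
      refine h3.trans ?_
      have hne : (1 + ζ) ≠ 0 := Complex.slitPlane_ne_zero (hslit ζ hζ')
      rw [neg_add, Complex.exp_add, Complex.exp_neg, Complex.exp_neg, Complex.exp_log hne, pow_succ]
      field_simp [Complex.exp_ne_zero w]
  have hd : DifferentiableOn ℂ (fun ζ => f (w + Complex.log (1 + ζ))) (Metric.closedBall 0 ρ) := by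
    refine hf.comp ?_ fun ζ hζ => hρ w hw ζ (mem_closedBall_zero_iff.1 hζ)
    refine DifferentiableOn.const_add _ (DifferentiableOn.clog (by fun_prop) fun ζ hζ => ?_)
    exact hslit ζ (mem_closedBall_zero_iff.1 hζ)
  have hc := Complex.norm_iteratedDeriv_le_of_forall_mem_sphere_norm_le
    (C := B * (1 + ρ) ^ n * Real.exp (n * w.re)) p hρ0 (hd.diffContOnCl_ball Subset.rfl) ?_
  · rw [hiter p 0 (Metric.mem_ball_self hρ0), norm_mul, norm_pow, Complex.norm_exp,
      ← Real.exp_nat_mul] at hc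
    simpa using hc
  · intro ζ hζ
    have hζ' : ‖ζ‖ = ρ := mem_sphere_zero_iff_norm.1 hζ
    have hne : (1 + ζ) ≠ 0 := Complex.slitPlane_ne_zero (hslit ζ hζ'.le)
    refine (hB _ (hρ w hw ζ hζ'.le)).trans ?_
    rw [Complex.add_re, Complex.log_re, mul_add, Real.exp_add, Real.exp_nat_mul (Real.log _),
      Real.exp_log (norm_pos_iff.2 hne)]
    have h1 : ‖1 + ζ‖ ≤ 1 + ρ := by
      refine (norm_add_le _ _).trans ?_
      rw [norm_one, hζ']
    rw [mul_assoc, mul_comm ((1 + ρ) ^ n)]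
    gcongr

/-- Subtracting the partial sum with p terms does not change the p-th derivative, and in the Cauchy
estimate the powers of |z| cancel, which gives a uniform bound. With p+1 terms, the derivative is
p!·c_p plus an error O(|z|), which gives the limit. -/
theorem zDeriv_iter_of_expansion {γ r ρ : ℝ} (hρ0 : 0 < ρ) (hρ1 : ρ < 1)
    (hρ : ∀ w ∈ sector γ, ∀ ζ : ℂ, ‖ζ‖ ≤ ρ → w + Complex.log (1 + ζ) ∈ sector r)
    {f : ℂ → ℂ} (hf : DifferentiableOn ℂ f (sector r)) {c : ℕ → ℂ} {B : ℕ → ℝ}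
    (hB : ∀ n, ∀ w ∈ sector r,
      ‖f w - ∑ k ∈ Finset.range n, c k * Complex.exp w ^ k‖ ≤ B n * Real.exp (n * w.re)) (p : ℕ) :
    (∀ w ∈ sector γ, ‖zDeriv^[p] f w‖ ≤ p.factorial * (B p * (1 + ρ) ^ p) / ρ ^ p) ∧
      Tendsto (zDeriv^[p] f) (sectorZero γ) (𝓝 (p.factorial * c p)) := by
  set P : ℕ → Polynomial ℂ := fun n =>
    ∑ k ∈ Finset.range n, Polynomial.C (c k) * Polynomial.X ^ k with hP
  have hPe : ∀ n w, (P n).eval (Complex.exp w)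
      = ∑ k ∈ Finset.range n, c k * Complex.exp w ^ k := by
    intro n w
    simp [hP, Polynomial.eval_finsetSum]
  have hPd : ∀ n, Differentiable ℂ fun w => (P n).eval (Complex.exp w) := fun n =>
    (P n).differentiable.comp Complex.differentiable_exp
  have hsub : sector γ ⊆ sector r := fun w hw => by
    simpa using hρ w hw 0 (by simpa using hρ0.le)
  have hsplit : ∀ n, ∀ w ∈ sector γ, zDeriv^[p] f w
      = zDeriv^[p] (fun w => f w - (P n).eval (Complex.exp w)) w
        + (Polynomial.derivative^[p] (P n)).eval (Complex.exp w) := by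
    intro n w hw
    have h1 := zDeriv_iter_add (hf.sub (hPd n).differentiableOn)
      ((hPd n).differentiableOn (s := sector r)) p (hsub hw)
    rw [zDeriv_iter_polynomial_exp, Pi.add_apply] at h1
    rw [sub_add_cancel] at h1
    exact h1
  have hest : ∀ n, ∀ w ∈ sector γ,
      Real.exp (p * w.re) * ‖zDeriv^[p] (fun w => f w - (P n).eval (Complex.exp w)) w‖ ≤
        p.factorial * (B n * (1 + ρ) ^ n * Real.exp (n * w.re)) / ρ ^ p := fun n w hw =>
    norm_zDeriv_iter_le hρ0 hρ1 hρ (hf.sub (hPd n).differentiableOn)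
      (fun w hw => by simpa only [Pi.sub_apply, hPe] using hB n w hw) p hw
  have hdeg : ∀ n, ∀ m, n ≤ m → Polynomial.derivative^[m] (P n) = 0 := by
    intro n m hnm
    rw [hP, Polynomial.iterate_derivative_sum]
    refine Finset.sum_eq_zero fun k hk => ?_
    rw [Polynomial.iterate_derivative_C_mul, Polynomial.iterate_derivative_eq_zero, mul_zero]
    rw [Polynomial.natDegree_X_pow]
    exact (Finset.mem_range.1 hk).trans_le hnm
  constructor
  · intro w hw
    have h1 := hest p w hw
    rw [hsplit p w hw, hdeg p p le_rfl, Polynomial.eval_zero, add_zero]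
    refine le_of_mul_le_mul_left (h1.trans (le_of_eq ?_)) (Real.exp_pos (p * w.re))
    ring
  · have hlead : ∀ w, (Polynomial.derivative^[p] (P (p + 1))).eval w = p.factorial * c p := by
      intro w
      have h1 : P (p + 1) = P p + Polynomial.C (c p) * Polynomial.X ^ p :=
        Finset.sum_range_succ _ _
      rw [h1, iterate_map_add, hdeg p p le_rfl, zero_add,
        Polynomial.iterate_derivative_C_mul, Polynomial.iterate_derivative_X_pow_eq_natCast_mul]
      simp [Nat.descFactorial_self, mul_comm]
    have hlim : Tendsto (fun w : ℂ => p.factorial * (B (p + 1) * (1 + ρ) ^ (p + 1)) / ρ ^ p *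
        Real.exp w.re) (sectorZero γ) (𝓝 0) := by
      have h1 : Tendsto Complex.re (sectorZero γ) atBot := tendsto_comap.mono_left inf_le_left
      simpa using (Real.tendsto_exp_atBot.comp h1).const_mul
        (p.factorial * (B (p + 1) * (1 + ρ) ^ (p + 1)) / ρ ^ p)
    rw [tendsto_iff_norm_sub_tendsto_zero]
    refine squeeze_zero' (Eventually.of_forall fun _ => norm_nonneg _) ?_ hlim
    filter_upwards [mem_inf_of_right (mem_principal_self (sector γ))] with w hw
    rw [hsplit (p + 1) w hw, hlead, add_sub_cancel_right]
    refine le_of_mul_le_mul_left ((hest (p + 1) w hw).trans (le_of_eq ?_))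
      (Real.exp_pos (p * w.re))
    rw [Nat.cast_add, Nat.cast_one, add_mul, one_mul, Real.exp_add]
    ring

/-! ### Truncated power series -/

/-- The power series `∑ b_k e^{ky}`, truncated outside half of its disc of convergence. -/
def truncSeries (Q : ℝ) (b : ℕ → ℂ) (y : ℝ) : ℂ :=
  if Q * Real.exp y < 1 / 2 then ∑' k, b k * (Real.exp (k * y) : ℂ) else 0

section TruncSeries

variable {Q A : ℝ} {b b' : ℕ → ℂ}

theorem norm_series_term_le (hb : ∀ k, ‖b k‖ ≤ A * Q ^ k) (y : ℝ) (k : ℕ) :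
    ‖b k * (Real.exp (k * y) : ℂ)‖ ≤ A * (Q * Real.exp y) ^ k := by
  rw [norm_mul, Complex.norm_real, Real.norm_of_nonneg (Real.exp_pos _).le, Real.exp_nat_mul,
    mul_pow, ← mul_assoc]
  exact mul_le_mul_of_nonneg_right (hb k) (by positivity)

theorem summable_series (hQ : 0 < Q) (hb : ∀ k, ‖b k‖ ≤ A * Q ^ k) {y : ℝ}
    (hy : Q * Real.exp y < 1 / 2) : Summable fun k => b k * (Real.exp (k * y) : ℂ) :=
  Summable.of_norm_bounded ((summable_geometric_of_lt_one (by positivity)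
    (hy.trans (by norm_num))).mul_left A) (norm_series_term_le hb y)

theorem aestronglyMeasurable_truncSeries (hQ : 0 < Q) (hb : ∀ k, ‖b k‖ ≤ A * Q ^ k) :
    AEStronglyMeasurable (truncSeries Q b) := by
  refine Measurable.aestronglyMeasurable ?_
  refine measurable_of_tendsto_metrizable (f := fun n y => if Q * Real.exp y < 1 / 2 then
    ∑ k ∈ Finset.range n, b k * (Real.exp (k * y) : ℂ) else 0) (fun n => ?_)
    (tendsto_pi_nhds.2 fun y => ?_)
  · refine Measurable.ite (measurableSet_lt (by fun_prop) measurable_const) ?_ measurable_const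
    fun_prop
  · by_cases hy : Q * Real.exp y < 1 / 2
    · simp only [truncSeries, if_pos hy]
      exact (summable_series hQ hb hy).hasSum.tendsto_sum_nat
    · simp only [truncSeries, if_neg hy]
      exact tendsto_const_nhds

/-- The estimate has to hold for every y because it is integrated over the whole line. Inside the
truncation it is a geometric tail of ratio below 1/2. Outside only the partial sum remains, and
2Qe^y ≥ 1 lets each lower power be replaced by the N-th, with the factors 2^{-k} keeping the sum
below 2. -/
theorem norm_truncSeries_sub_le (hQ : 0 < Q) (hA : 0 ≤ A) (hb : ∀ k, ‖b k‖ ≤ A * Q ^ k) (N : ℕ)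
    (y : ℝ) :
    ‖truncSeries Q b y - ∑ k ∈ Finset.range N, b k * (Real.exp (k * y) : ℂ)‖ ≤
      2 * A * (2 * Q) ^ N * Real.exp (N * y) := by
  have hQy : 0 < Q * Real.exp y := by positivity
  have hrhs : 2 * A * (2 * Q) ^ N * Real.exp (N * y) = 2 * A * (2 * (Q * Real.exp y)) ^ N := by
    rw [Real.exp_nat_mul]
    ring
  rw [hrhs]
  by_cases hy : Q * Real.exp y < 1 / 2
  · rw [truncSeries, if_pos hy, ← (summable_series hQ hb hy).sum_add_tsum_nat_add N,
      add_sub_cancel_left]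
    have hgeo := (hasSum_geometric_of_lt_one hQy.le (hy.trans (by norm_num))).mul_left
      (A * (Q * Real.exp y) ^ N)
    refine (tsum_of_norm_bounded hgeo fun k => ?_).trans ?_
    · refine (norm_series_term_le hb y (k + N)).trans (le_of_eq ?_)
      rw [pow_add]
      ring
    · have h1 : (1 - Q * Real.exp y)⁻¹ ≤ 2 := by
        rw [inv_le_comm₀ (by linarith) two_pos]
        linarith
      calc A * (Q * Real.exp y) ^ N * (1 - Q * Real.exp y)⁻¹
          ≤ A * (2 * (Q * Real.exp y)) ^ N * 2 := by
            have h2 : 0 ≤ (1 - Q * Real.exp y)⁻¹ := inv_nonneg.2 (by linarith)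
            have h3 : Q * Real.exp y ≤ 2 * (Q * Real.exp y) := by linarith
            have h4 := pow_le_pow_left₀ hQy.le h3 N
            gcongr
        _ = _ := by ring
  · rw [truncSeries, if_neg hy, zero_sub, norm_neg]
    have hs : 1 ≤ 2 * (Q * Real.exp y) := by linarith [not_lt.1 hy]
    have h2 : ∑ k ∈ Finset.range N, (1 / 2 : ℝ) ^ k ≤ 2 := by
      have := Summable.sum_le_tsum (Finset.range N) (fun k _ => by positivity)
        summable_geometric_two
      rwa [tsum_geometric_two] at this
    calc ‖∑ k ∈ Finset.range N, b k * (Real.exp (k * y) : ℂ)‖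
        ≤ ∑ k ∈ Finset.range N, A * (2 * (Q * Real.exp y)) ^ N * (1 / 2 : ℝ) ^ k := by
          refine norm_sum_le_of_le _ fun k hk => (norm_series_term_le hb y k).trans ?_
          have h3 : (2 * (Q * Real.exp y)) ^ k ≤ (2 * (Q * Real.exp y)) ^ N :=
            pow_le_pow_right₀ hs (Finset.mem_range.1 hk).le
          calc A * (Q * Real.exp y) ^ k
              = A * (2 * (Q * Real.exp y)) ^ k * (1 / 2 : ℝ) ^ k := by
                rw [mul_assoc, ← mul_pow]
                ring_nf
            _ ≤ _ := by gcongr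
      _ = A * (2 * (Q * Real.exp y)) ^ N * ∑ k ∈ Finset.range N, (1 / 2 : ℝ) ^ k :=
          (Finset.mul_sum _ _ _).symm
      _ ≤ A * (2 * (Q * Real.exp y)) ^ N * 2 := by gcongr
      _ = _ := by ring

theorem norm_truncSeries_le (hQ : 0 < Q) (hA : 0 ≤ A) (hb : ∀ k, ‖b k‖ ≤ A * Q ^ k) (y : ℝ) :
    ‖truncSeries Q b y‖ ≤ 2 * A := by
  simpa using norm_truncSeries_sub_le hQ hA hb 0 y

theorem truncSeries_add {A' : ℝ} (hQ : 0 < Q) (hb : ∀ k, ‖b k‖ ≤ A * Q ^ k)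
    (hb' : ∀ k, ‖b' k‖ ≤ A' * Q ^ k) (y : ℝ) :
    truncSeries Q (b + b') y = truncSeries Q b y + truncSeries Q b' y := by
  by_cases hy : Q * Real.exp y < 1 / 2
  · simp only [truncSeries, if_pos hy, Pi.add_apply, add_mul]
    exact (summable_series hQ hb hy).tsum_add (summable_series hQ hb' hy)
  · simp only [truncSeries, if_neg hy, add_zero]

theorem truncSeries_smul (c : ℂ) (y : ℝ) :
    truncSeries Q (c • b) y = c * truncSeries Q b y := by
  by_cases hy : Q * Real.exp y < 1 / 2
  · simp only [truncSeries, if_pos hy, Pi.smul_apply, smul_eq_mul, mul_assoc]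
    exact tsum_mul_left
  · simp only [truncSeries, if_neg hy, mul_zero]

end TruncSeries

/-! ### The truncated Laplace transform -/

/-- The truncated Laplace transform with kernel `q` of a power series. -/
def truncLaplace (q : ℂ → ℂ) (Q : ℝ) (b : ℕ → ℂ) (w : ℂ) : ℂ :=
  ∫ y : ℝ, q (y - w) * truncSeries Q b y

section TruncLaplace

variable {q : ℂ → ℂ} {r Q A : ℝ} {M : ℕ → ℝ} {b b' : ℕ → ℂ} {w : ℂ}

theorem norm_le_of_decay
    (hM : ∀ N : ℕ, ∀ w ∈ sector r, Real.exp (N * w.re) * ‖q w‖ ≤ M N * Real.exp (-|w.re|)) :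
    ∀ w ∈ sector r, ‖q w‖ ≤ M 0 * Real.exp (-|w.re|) := fun w hw => by
  simpa using hM 0 w hw

theorem integrable_truncLaplace (hq : DifferentiableOn ℂ q (sector r))
    (hM : ∀ N : ℕ, ∀ w ∈ sector r, Real.exp (N * w.re) * ‖q w‖ ≤ M N * Real.exp (-|w.re|))
    (hQ : 0 < Q) (hA : 0 ≤ A) (hb : ∀ k, ‖b k‖ ≤ A * Q ^ k) (hw : w ∈ sector r) :
    Integrable fun y : ℝ => q (y - w) * truncSeries Q b y :=
  integrable_laplace hq (hM 0) (aestronglyMeasurable_truncSeries hQ hb) (A := 2 * A)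
    (by simpa using norm_truncSeries_le hQ hA hb) hw

theorem differentiableOn_truncLaplace (hq : DifferentiableOn ℂ q (sector r))
    (hM : ∀ N : ℕ, ∀ w ∈ sector r, Real.exp (N * w.re) * ‖q w‖ ≤ M N * Real.exp (-|w.re|))
    (hQ : 0 < Q) (hA : 0 ≤ A) (hb : ∀ k, ‖b k‖ ≤ A * Q ^ k) :
    DifferentiableOn ℂ (truncLaplace q Q b) (sector r) :=
  differentiableOn_laplace hq (norm_le_of_decay hM) (aestronglyMeasurable_truncSeries hQ hb)
    (norm_truncSeries_le hQ hA hb)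

/-- Monomials are transformed exactly, so the remainder of the transform is the transform of the
remainder of the truncated series. -/
theorem norm_truncLaplace_sub_le (hr : 0 < r) (hq : DifferentiableOn ℂ q (sector r))
    (hM : ∀ N : ℕ, ∀ w ∈ sector r, Real.exp (N * w.re) * ‖q w‖ ≤ M N * Real.exp (-|w.re|))
    (hQ : 0 < Q) (hA : 0 ≤ A) (hb : ∀ k, ‖b k‖ ≤ A * Q ^ k) (N : ℕ) (hw : w ∈ sector r) :
    ‖truncLaplace q Q b w - ∑ k ∈ Finset.range N, b k * moment q k * Complex.exp w ^ k‖ ≤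
      2 * A * (2 * Q) ^ N * M N * (∫ x : ℝ, Real.exp (-|x|)) * Real.exp (N * w.re) := by
  have hint : ∀ k : ℕ, Integrable fun y : ℝ => q (y - w) * (Real.exp (k * y) : ℂ) := fun k =>
    integrable_laplace hq (hM k) (Continuous.aestronglyMeasurable (by fun_prop)) (A := 1)
      (fun y => by
        rw [Complex.norm_real, Real.norm_of_nonneg (Real.exp_pos _).le, one_mul]) hw
  have hsum : truncLaplace q Q b w - ∑ k ∈ Finset.range N, b k * moment q k * Complex.exp w ^ k
      = ∫ y : ℝ, q (y - w) * (truncSeries Q b y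
          - ∑ k ∈ Finset.range N, b k * (Real.exp (k * y) : ℂ)) := by
    have h1 : ∀ k ∈ Finset.range N, b k * moment q k * Complex.exp w ^ k
        = ∫ y : ℝ, b k * (q (y - w) * (Real.exp (k * y) : ℂ)) := by
      intro k _
      rw [integral_const_mul, laplace_exp hq hr (hM k) hw, mul_assoc]
    rw [Finset.sum_congr rfl h1, ← integral_finsetSum _ fun k _ => (hint k).const_mul (b k),
      truncLaplace, ← integral_sub (integrable_truncLaplace hq hM hQ hA hb hw)
        (integrable_finsetSum _ fun k _ => (hint k).const_mul (b k))]
    refine integral_congr_ae (Eventually.of_forall fun y => ?_)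
    simp only
    rw [mul_sub, Finset.mul_sum]
    congr 1
    exact Finset.sum_congr rfl fun k _ => by ring
  rw [hsum]
  exact norm_laplace_le (hM N) (norm_truncSeries_sub_le hQ hA hb N) hw

theorem truncLaplace_add {A' : ℝ} (hq : DifferentiableOn ℂ q (sector r))
    (hM : ∀ N : ℕ, ∀ w ∈ sector r, Real.exp (N * w.re) * ‖q w‖ ≤ M N * Real.exp (-|w.re|))
    (hQ : 0 < Q) (hA : 0 ≤ A) (hA' : 0 ≤ A') (hb : ∀ k, ‖b k‖ ≤ A * Q ^ k)
    (hb' : ∀ k, ‖b' k‖ ≤ A' * Q ^ k) (hw : w ∈ sector r) :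
    truncLaplace q Q (b + b') w = truncLaplace q Q b w + truncLaplace q Q b' w := by
  simp only [truncLaplace, truncSeries_add hQ hb hb', mul_add]
  exact integral_add (integrable_truncLaplace hq hM hQ hA hb hw)
    (integrable_truncLaplace hq hM hQ hA' hb' hw)

theorem truncLaplace_smul (c : ℂ) :
    truncLaplace q Q (c • b) w = c * truncLaplace q Q b w := by
  simp only [truncLaplace, truncSeries_smul, mul_left_comm _ c]
  exact integral_const_mul _ _

end TruncLaplace

/-! ### The extension operator -/

theorem SeqSpace.norm_val_le {S : ℕ → ℝ} (hS : ∀ k, 0 < S k) {h : ℝ} (hh : 0 < h)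
    (a : SeqSpace (hat S) h) (k : ℕ) : ‖a.val k‖ ≤ ‖a‖ * (h ^ k * (k.factorial * S k)) := by
  have h1 : ‖a.val k‖ / |h ^ k * hat S k| ≤ ‖a‖ := le_ciSup a.bdd k
  have h2 : 0 < h ^ k * (k.factorial * S k) := by
    have := hS k
    positivity
  rw [hat, abs_of_pos h2, div_le_iff₀ h2] at h1
  exact h1

theorem WeightedSpace.val_injective {V ι : Type*} [AddCommGroup V] [Module ℂ V]
    {T : V →ₗ[ℂ] (ι → ℂ)} {w : ι → ℝ} {f g : WeightedSpace T w} (h : f.val = g.val) : f = g :=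
  Subtype.ext h

/-- The coefficients `a_k / (k! m_k)` of the formal Borel transform. -/
def borelCoeff (q : ℂ → ℂ) (a : ℕ → ℂ) (k : ℕ) : ℂ := a k / (k.factorial * moment q k)

/-- Dividing by the moments in `borelCoeff` makes the transform restore a_k/k!; `hmoment` keeps
these coefficients below (θh)^k, and `hdecay` brings W_N into the remainders. In the new type, 2
comes from the truncation and (1+ρ)/ρ from the Cauchy estimate. -/
theorem exists_extension {q : ℂ → ℂ} {γ r ρ : ℝ} (hr : 0 < r) (hρ0 : 0 < ρ)
    (hρ1 : ρ < 1)
    (hρ : ∀ w ∈ sector γ, ∀ ζ : ℂ, ‖ζ‖ ≤ ρ → w + Complex.log (1 + ζ) ∈ sector r)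
    (hq : DifferentiableOn ℂ q (sector r)) {S W : ℕ → ℝ} (hS : ∀ k, 0 < S k) (hW : ∀ k, 0 < W k)
    {C c θ : ℝ} (hC : 0 ≤ C) (hc : 0 ≤ c) (hθ : 0 < θ)
    (hdecay : ∀ N : ℕ, ∀ w ∈ sector r,
      Real.exp (N * w.re) * ‖q w‖ ≤ C * W N * Real.exp (-|w.re|))
    (hmoment : ∀ k, S k ≤ c * θ ^ k * ‖moment q k‖) {h : ℝ} (hh : 0 < h) :
    ∃ E : SeqSpace (hat S) h →L[ℂ] UltraHol γ (hat W) (2 * θ * (1 + ρ) / ρ * h),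
      ∀ a, IsBorelImage (E a).val a.val := by
  have hQ : 0 < θ * h := by positivity
  have hm0 : ∀ k, 0 < ‖moment q k‖ := fun k => by
    refine norm_pos_iff.2 fun h0 => ?_
    have h1 := hmoment k
    rw [h0, norm_zero, mul_zero] at h1
    exact absurd (hS k) (not_lt.2 h1)
  have hcoeff : ∀ (a : SeqSpace (hat S) h) (k : ℕ),
      ‖borelCoeff q a.val k‖ ≤ ‖a‖ * c * (θ * h) ^ k := by
    intro a k
    have hk : 0 < (k.factorial : ℝ) * ‖moment q k‖ :=
      mul_pos (Nat.cast_pos.2 k.factorial_pos) (hm0 k)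
    rw [borelCoeff, norm_div, norm_mul, Complex.norm_natCast, div_le_iff₀ hk]
    refine (SeqSpace.norm_val_le hS hh a k).trans ?_
    calc ‖a‖ * (h ^ k * (k.factorial * S k))
        ≤ ‖a‖ * (h ^ k * (k.factorial * (c * θ ^ k * ‖moment q k‖))) := by
          gcongr
          exact hmoment k
      _ = _ := by ring
  have hA : ∀ a : SeqSpace (hat S) h, 0 ≤ ‖a‖ * c := fun a => by positivity
  have hsub : sector γ ⊆ sector r := fun w hw => by
    simpa using hρ w hw 0 (by simpa using hρ0.le)
  set F : SeqSpace (hat S) h → ℂ → ℂ := fun a => truncLaplace q (θ * h) (borelCoeff q a.val) with hF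
  have hFd : ∀ a, DifferentiableOn ℂ (F a) (sector r) := fun a =>
    differentiableOn_truncLaplace hq hdecay hQ (hA a) (hcoeff a)
  set J : ℝ := ∫ x : ℝ, Real.exp (-|x|) with hJ
  have hJ0 : 0 ≤ J := integral_nonneg fun x => (Real.exp_pos _).le
  have hexp : ∀ a, ∀ n : ℕ, ∀ w ∈ sector r,
      ‖F a w - ∑ k ∈ Finset.range n, a.val k / k.factorial * Complex.exp w ^ k‖ ≤
        2 * (‖a‖ * c) * (2 * (θ * h)) ^ n * (C * W n) * J * Real.exp (n * w.re) := by
    intro a n w hw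
    have h1 := norm_truncLaplace_sub_le hr hq hdecay hQ (hA a) (hcoeff a) n hw
    refine le_trans (le_of_eq ?_) h1
    congr 2
    refine Finset.sum_congr rfl fun k _ => ?_
    have h2 : moment q k ≠ 0 := norm_pos_iff.1 (hm0 k)
    have h3 : (k.factorial : ℂ) ≠ 0 := Nat.cast_ne_zero.2 k.factorial_ne_zero
    rw [borelCoeff]
    field_simp
  have hres := fun a p => zDeriv_iter_of_expansion hρ0 hρ1 hρ (hFd a) (hexp a) p
  let G : SeqSpace (hat S) h → Hol γ := fun a => ⟨(sector γ).indicator (F a),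
    ((hFd a).mono hsub).congr fun w hw => indicator_of_mem hw _,
    fun w hw => indicator_of_notMem hw _⟩
  have hGF : ∀ a, EqOn (G a : ℂ → ℂ) (F a) (sector γ) := fun a w hw => indicator_of_mem hw _
  have hbound : ∀ a (i : sector γ × ℕ), ‖derivs γ (G a) i‖ /
      |(2 * θ * (1 + ρ) / ρ * h) ^ i.2 * hat W i.2| ≤ 2 * c * C * J * ‖a‖ := by
    rintro a ⟨⟨w, hw⟩, p⟩
    have hWp := hW p
    have hpos : 0 < (2 * θ * (1 + ρ) / ρ * h) ^ p * hat W p := by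
      rw [hat]
      positivity
    rw [abs_of_pos hpos, div_le_iff₀ hpos]
    have h1 : derivs γ (G a) (⟨w, hw⟩, p) = zDeriv^[p] (F a) w := zDeriv_iter_congr (hGF a) p hw
    rw [h1]
    refine ((hres a p).1 w hw).trans (le_of_eq ?_)
    rw [hat, show 2 * θ * (1 + ρ) / ρ * h = 2 * (θ * h) * (1 + ρ) / ρ by ring, div_pow,
      mul_pow _ (1 + ρ)]
    ring
  let E₀ : SeqSpace (hat S) h →ₗ[ℂ] UltraHol γ (hat W) (2 * θ * (1 + ρ) / ρ * h) :=
    { toFun := fun a => ⟨G a, ⟨_, by rintro _ ⟨i, rfl⟩; exact hbound a i⟩⟩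
      map_add' := fun a b => by
        refine WeightedSpace.val_injective (Subtype.ext (funext fun w => ?_))
        change (sector γ).indicator (F (a + b)) w
          = (sector γ).indicator (F a) w + (sector γ).indicator (F b) w
        by_cases hw : w ∈ sector γ
        · simp only [indicator_of_mem hw, hF]
          rw [← truncLaplace_add hq hdecay hQ (hA a) (hA b) (hcoeff a) (hcoeff b) (hsub hw)]
          congr 1
          funext k
          exact add_div _ _ _
        · simp only [indicator_of_notMem hw, add_zero]
      map_smul' := fun z a => by
        refine WeightedSpace.val_injective (Subtype.ext (funext fun w => ?_))
        change (sector γ).indicator (F (z • a)) w = z * (sector γ).indicator (F a) w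
        by_cases hw : w ∈ sector γ
        · simp only [indicator_of_mem hw, hF]
          rw [← truncLaplace_smul]
          congr 1
          funext k
          exact mul_div_assoc _ _ _
        · simp only [indicator_of_notMem hw, mul_zero] }
  refine ⟨E₀.mkContinuous (2 * c * C * J) fun a => ?_, fun a p => ?_⟩
  · exact Real.iSup_le (fun i => hbound a i) (by positivity)
  · have h1 := (hres a p).2
    rw [mul_div_cancel₀ _ (Nat.cast_ne_zero.2 p.factorial_ne_zero)] at h1
    refine h1.congr' ?_
    filter_upwards [mem_inf_of_right (mem_principal_self (sector γ))] with w hw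
    exact (zDeriv_iter_congr (hGF a) p hw).symm

/-! ### Lower bounds for moments -/

/-- For each y ≥ 0 keep only the part x ≤ y - log K of the moment integral. There Ke^x ≤ e^y, so the
flat factor is at least exp(-σ(e^y)/l - c), and the remaining exponential e^{(k+1)x} integrates
explicitly. -/
theorem weightMatrix_le_moment {σ η : ℝ → ℝ} {q : ℂ → ℂ} {l K c : ℝ} (hσ : IsWeightFunction σ)
    (hl : 0 < l) (hK : 0 < K) (hq : ∀ x : ℝ, q x = (Real.exp (x - η x) : ℂ))
    (hη : ∀ x, η x ≤ σ (K * Real.exp x) / l + c) (k : ℕ)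
    (hint : Integrable fun x : ℝ => q x * Real.exp (k * x)) :
    weightMatrix σ l k ≤ Real.exp c * K * (2 * K) ^ k * ‖moment q k‖ := by
  have hint' : Integrable fun x : ℝ => Real.exp (x - η x) * Real.exp (k * x) := by
    refine hint.re.congr (Eventually.of_forall fun x => ?_)
    simp only [hq, RCLike.re_eq_complex_re, ← Complex.ofReal_mul, Complex.ofReal_re]
  have hm : moment q k = ((∫ x : ℝ, Real.exp (x - η x) * Real.exp (k * x) : ℝ) : ℂ) := by
    rw [moment, ← integral_complex_ofReal]
    simp only [hq, Complex.ofReal_mul]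
  have hnorm : ‖moment q k‖ = ∫ x : ℝ, Real.exp (x - η x) * Real.exp (k * x) := by
    rw [hm, Complex.norm_real, Real.norm_of_nonneg (integral_nonneg fun x => by positivity)]
  refine weightMatrix_le hl k fun y hy => ?_
  have hk1 : (0 : ℝ) < (k : ℝ) + 1 := by positivity
  have hlow : Real.exp (-(σ (Real.exp y) / l + c)) *
      (Real.exp ((k + 1) * (y - Real.log K)) / (k + 1)) ≤ ‖moment q k‖ := by
    rw [hnorm, ← integral_exp_mul_Iic hk1, ← integral_const_mul]
    refine (setIntegral_mono_on ((integrableOn_exp_mul_Iic hk1 _).const_mul _) hint'.integrableOn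
      measurableSet_Iic fun x hx => ?_).trans
      (setIntegral_le_integral hint' (Eventually.of_forall fun x => by positivity))
    rw [← Real.exp_add, ← Real.exp_add, Real.exp_le_exp]
    have h1 : K * Real.exp x ≤ Real.exp y := by
      rw [← Real.exp_log hK, ← Real.exp_add, Real.exp_le_exp]
      rw [mem_Iic] at hx
      linarith
    have h2 : σ (K * Real.exp x) / l ≤ σ (Real.exp y) / l := by
      gcongr
      exact hσ.monotoneOn (mem_Ici.2 (by positivity)) (mem_Ici.2 (Real.exp_pos y).le) h1
    linarith [hη x]
  have hpow : ((k : ℝ) + 1) ≤ 2 ^ k := by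
    exact_mod_cast Nat.lt_two_pow_self (n := k)
  have hKe : Real.exp (((k : ℝ) + 1) * (y - Real.log K)) * K ^ (k + 1)
      = Real.exp (((k : ℝ) + 1) * y) := by
    nth_rewrite 2 [← Real.exp_log hK]
    rw [← Real.exp_nat_mul, ← Real.exp_add]
    congr 1
    push_cast
    ring
  calc Real.exp (k * y - σ (Real.exp y) / l)
      -- Passing from k to k+1 is free because y ≥ 0; it matches the extra factor e^x in q.
      ≤ Real.exp ((k + 1) * y - σ (Real.exp y) / l) := by
        rw [Real.exp_le_exp]
        linarith
    _ = Real.exp c * K ^ (k + 1) * (k + 1) * (Real.exp (-(σ (Real.exp y) / l + c)) *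
          (Real.exp ((k + 1) * (y - Real.log K)) / (k + 1))) := by
        rw [sub_eq_add_neg, Real.exp_add, ← hKe, neg_add, Real.exp_add, Real.exp_neg c]
        field_simp
    _ ≤ Real.exp c * K ^ (k + 1) * 2 ^ k * ‖moment q k‖ := by gcongr
    _ = _ := by
        rw [mul_pow]
        ring

/-- The extension operator for fixed data: the constant `k₀` only depends on `σ`, `ω`, `γ`. -/
theorem exists_extension_weightMatrix {σ ω : ℝ → ℝ} (hσ : IsNormalizedWeightFunction σ)
    (hω : IsNormalizedWeightFunction ω) (hω3 : Omega3 ω) {γ r : ℝ} (hr : 0 < r) (hγr : γ < r)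
    (hg : MixedGrowth σ ω r) :
    ∃ k₀ : ℝ, 0 < k₀ ∧ ∀ D : ℝ, 1 ≤ D → (∃ C : ℝ, ∀ t : ℝ, 0 ≤ t → ω t ≤ D * σ t + C) →
      ∀ x h : ℝ, 0 < x → 0 < h →
        ∃ E : SeqSpace (hat (weightMatrix σ x)) h →L[ℂ]
            UltraHol γ (hat (weightMatrix ω (8 * D * x))) (k₀ * h),
          ∀ a, IsBorelImage (E a).val a.val := by
  obtain ⟨H, K, hK1, hH, hHlow, hHup⟩ :=
    hg.exists_flat_exponent hω.toIsWeightFunction hσ.toIsWeightFunction hr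
  obtain ⟨ρ, hρ0, hρ1, hρ⟩ := exists_radius hγr
  have hK0 : 0 < K := one_pos.trans_le hK1
  refine ⟨2 * (2 * K) * (1 + ρ) / ρ, by positivity, fun D hD ⟨C, hC⟩ x h hx hh => ?_⟩
  have hD0 : 0 < D := one_pos.trans_le hD
  have hl : 0 < 4 * D * x := by positivity
  have hr0 : ∀ y : ℝ, (y : ℂ) ∈ sector r := fun y => by
    simp only [sector, mem_ofPred_eq, Complex.ofReal_im, abs_zero]
    positivity
  -- The divisor 2Dx is chosen so that (ω+σ)/(2Dx) ≤ σ/x + const on the ray, by ω ≤ Dσ + C and D ≥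
  -- 1. The factor e^w supplies integrability as Re w → -∞.
  set q : ℂ → ℂ := fun w => Complex.exp (w - H w / ((2 * D * x : ℝ) : ℂ)) with hqdef
  have hqd : DifferentiableOn ℂ q (sector r) :=
    (differentiableOn_id.sub (hH.div_const _)).cexp
  have hqn : ∀ w ∈ sector r, ‖q w‖ ≤ Real.exp (w.re - ω (Real.exp w.re) / (4 * D * x)) := by
    intro w hw
    simp only [hqdef]
    rw [Complex.norm_exp, Complex.sub_re, Complex.div_ofReal_re, Real.exp_le_exp]
    have h1 : ω (Real.exp w.re) / (4 * D * x) = ω (Real.exp w.re) / 2 / (2 * D * x) := by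
      field_simp
      ring
    rw [h1]
    have h2 := hHlow w hw
    gcongr
  obtain ⟨B, hB0, hB⟩ := exists_exp_mul_exp_le hω hω3 hl
  have hdecay : ∀ N : ℕ, ∀ w ∈ sector r, Real.exp (N * w.re) * ‖q w‖ ≤
      B * weightMatrix ω (8 * D * x) N * Real.exp (-|w.re|) := by
    intro N w hw
    rw [show 8 * D * x = 2 * (4 * D * x) by ring]
    refine le_trans ?_ (hB N w.re)
    have := hqn w hw
    gcongr
  have hqx : ∀ y : ℝ, q y = (Real.exp (y - (H y).re / (2 * D * x)) : ℂ) := by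
    intro y
    have h1 : H y = ((H y).re : ℂ) := Complex.ext (by simp) (by simp [(hHup y).1])
    simp only [hqdef]
    rw [h1]
    push_cast
    simp
  have hη : ∀ y : ℝ, (H y).re / (2 * D * x) ≤
      σ (K * Real.exp y) / x + (C + 1) / (2 * D * x) := by
    intro y
    have hσ0 : 0 ≤ σ (K * Real.exp y) := hσ.nonneg (by positivity)
    have h1 := (hHup y).2
    have h2 := hC (K * Real.exp y) (by positivity)
    have h3 : σ (K * Real.exp y) ≤ D * σ (K * Real.exp y) := le_mul_of_one_le_left hσ0 hD
    have h4 : σ (K * Real.exp y) / x = 2 * D * σ (K * Real.exp y) / (2 * D * x) := by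
      field_simp
    rw [h4, ← add_div]
    gcongr
    linarith
  have hint : ∀ k : ℕ, Integrable fun y : ℝ => q y * Real.exp (k * y) := by
    intro k
    have h1 := integrable_laplace hqd (hdecay k) (g := fun y : ℝ => (Real.exp (k * y) : ℂ))
      (Continuous.aestronglyMeasurable (by fun_prop)) (A := 1) (w := 0)
      (fun y => by
        rw [Complex.norm_real, Real.norm_of_nonneg (Real.exp_pos _).le, one_mul])
      (by simpa using hr0 0)
    simpa only [sub_zero] using h1
  exact exists_extension hr hρ0 hρ1 hρ hqd (weightMatrix_pos σ x)
    (weightMatrix_pos ω (8 * D * x)) hB0.le (by positivity) (by positivity) hdecay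
    (fun k => weightMatrix_le_moment hσ.toIsWeightFunction hx hK0 hqx hη k (hint k)) hh

end MixedExt

end

/-! ### The mixed extension theorem -/

theorem mainTheorem1 (σ ω : ℝ → ℝ)
    (hσ : MixedExt.IsNormalizedWeightFunction σ) (hω : MixedExt.IsNormalizedWeightFunction ω)
    (hσ3 : MixedExt.Omega3 σ) (hω3 : MixedExt.Omega3 ω)
    (hpos : 0 < MixedExt.mixedIndex σ ω)
    (γ : ℝ) (hγ : 0 < γ) (hγlt : ENNReal.ofReal γ < MixedExt.mixedIndex σ ω) :
    (∃ D : ℝ, 1 ≤ D ∧ ∃ C : ℝ, ∀ t : ℝ, 0 ≤ t → ω t ≤ D * σ t + C) ∧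
    (∃ k₀ : ℝ, 0 < k₀ ∧
      ∀ D : ℝ, 1 ≤ D → (∃ C : ℝ, ∀ t : ℝ, 0 ≤ t → ω t ≤ D * σ t + C) →
        ∀ x h : ℝ, 0 < x → 0 < h →
          ∃ E : MixedExt.SeqSpace (MixedExt.hat (MixedExt.weightMatrix σ x)) h →L[ℂ]
              MixedExt.UltraHol γ (MixedExt.hat (MixedExt.weightMatrix ω (8 * D * x))) (k₀ * h),
            ∀ a, MixedExt.IsBorelImage (E a).val a.val) ∧
    MixedExt.roumieuSeq (fun x => MixedExt.hat (MixedExt.weightMatrix σ x)) ⊆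
      MixedExt.borelImage
        (MixedExt.roumieuHol γ (fun x => MixedExt.hat (MixedExt.weightMatrix ω x))) := by
  -- The strict inequality γ < r leaves room for the Cauchy discs around points of S_γ.
  obtain ⟨r, hγr, hg⟩ := MixedExt.exists_mixedGrowth_of_lt hγlt
  have hr : 0 < r := hγ.trans hγr
  have hD := hg.exists_le hω.toIsWeightFunction hσ.toIsWeightFunction hr
  have hE := MixedExt.exists_extension_weightMatrix hσ hω hω3 hr hγr hg
  refine ⟨hD, hE, ?_⟩
  obtain ⟨D, hD1, hDC⟩ := hD
  obtain ⟨k₀, hk₀, hE⟩ := hE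
  rintro _ ⟨x, h, hx, hh, b, rfl⟩
  obtain ⟨E, hEb⟩ := hE D hD1 hDC x h hx hh
  exact ⟨(E b).val, ⟨8 * D * x, k₀ * h, by positivity, by positivity, E b, rfl⟩, hEb b⟩
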